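/- All vector spaces are over $\mathbb{C}$. For $\boldsymbol a,\boldsymbol b\in\mathbb{Z}_2\times\mathbb{Z}_2$ put $\boldsymbol a\cdot\boldsymbol b=a_1b_1+a_2b_2$. A $\mathbb{Z}_2\times\mathbb{Z}_2$-graded Lie superalgebra is a vector space $\mathfrak g=\bigoplus_{\boldsymbol a\in\mathbb{Z}_2\times\mathbb{Z}_2}\mathfrak g_{\boldsymbol a}$ with a bilinear bracket satisfying, for homogeneous $x\in\mathfrak g_{\boldsymbol a}$, $y\in\mathfrak g_{\boldsymbol b}$, $z\in\mathfrak g_{\boldsymbol c}$, $$[\![x,y]\!]\in\mathfrak g_{\boldsymbol a+\boldsymbol b},\qquad [\![x,y]\!]=-(-1)^{\boldsymbol a\cdot\boldsymbol b}[\![y,x]\!],\qquad [\![x,[\![y,z]\!]]\!]=[\![[\![x,y]\!],z]\!]+(-1)^{\boldsymbol a\cdot\boldsymbol b}[\![y,[\![x,z]\!]]\!].$$ Let $I=\begin{pmatrix}0&1\\1&0\end{pmatrix}$, $J=\begin{pmatrix}0&1\\-1&0\end{pmatrix}$, and $\mathbb{Z}^*=\mathbb{Z}\setminus\{0\}$.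 Consider matrices with rows and columns indexed by $\mathbb{Z}$, having only finitely many nonzero entries. Divide the index set into blocks: block $0$ is $\{0\}$, block $i>0$ is $(2i-1,2i)$, and block $-i<0$ is $(-2i,-2i+1)$; write $Y_{ij}$ for the corresponding blocks of $Y$. The algebra $\mathfrak{pso}(\infty|\infty)$ consists of all such matrices $Y$ with $Y_{00}=0$ and, for all integers $i,j\ge 1$, $$IY_{-i,-j}+Y_{-j,-i}^TI=0,\quad JY_{i,j}+Y_{j,i}^TJ=0,\quad IY_{-i,j}+Y_{j,-i}^TJ=0,\quad Y_{0,-j}+Y_{-j,0}^TI=0,\quad Y_{0,j}-Y_{j,0}^TJ=0.$$ When rows and columns are divided into those of negative, zero and positive index, the grading is $$\begin{pmatrix}\mathfrak g_{(0,0)}&\mathfrak g_{(1,1)}&\mathfrak g_{(0,1)}\\ \mathfrak g_{(1,1)}&0&\mathfrak g_{(1,0)}\\ \mathfrak g_{(0,1)}&\mathfrak g_{(1,0)}&\mathfrak g_{(0,0)}\end{pmatrix},$$ and $[\![x,y]\!]=xy-(-1)^{\boldsymbol a\cdot\boldsymbol b}yx$ for $x\in\mathfrak g_{\boldsymbol a}$,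 $y\in\mathfrak g_{\boldsymbol b}$, extended bilinearly. With matrix units $e_{pq}$, define for $i\ge 1$ $$\bar c_{-i}^{\,+}=\sqrt2(e_{-2i,0}-e_{0,-2i+1}),\quad \bar c_{-i}^{\,-}=\sqrt2(e_{0,-2i}-e_{-2i+1,0}),\quad \bar c_i^{\,+}=\sqrt2(e_{0,2i}+e_{2i-1,0}),\quad \bar c_i^{\,-}=\sqrt2(e_{0,2i-1}-e_{2i,0}).$$ Write $\bar f_j^{\,\pm}=\bar c_j^{\,\pm}$ for $j<0$ (parafermions, of degree $(1,1)$) and $\bar b_j^{\,\pm}=\bar c_j^{\,\pm}$ for $j>0$ (parabosons, of degree $(1,0)$). **Theorem.** As a $\mathbb{Z}_2\times\mathbb{Z}_2$-graded Lie superalgebra defined by generators and relations, $\mathfrak{pso}(\infty|\infty)$ is generated by the elements $\bar c_i^{\,\pm}$ ($i\in\mathbb{Z}^*$), with $\bar f_j^{\,\pm}$ of degree $(1,1)$ and $\bar b_j^{\,\pm}$ of degree $(1,0)$, subject to the relations, for all $\xi,\eta,\epsilon\in\{+,-\}\equiv\{+1,-1\}$ and all $j,k,l\in\mathbb{Z}^*$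 that are negative where they index an $\bar f$ and positive where they index a $\bar b$, $$[[\bar f_j^{\,\xi},\bar f_k^{\,\eta}],\bar f_l^{\,\epsilon}]=|\epsilon-\eta|\,\delta_{kl}\,\bar f_j^{\,\xi}-|\epsilon-\xi|\,\delta_{jl}\,\bar f_k^{\,\eta},$$ $$[\{\bar b_j^{\,\xi},\bar b_k^{\,\eta}\},\bar b_l^{\,\epsilon}]=(\epsilon-\xi)\,\delta_{jl}\,\bar b_k^{\,\eta}+(\epsilon-\eta)\,\delta_{kl}\,\bar b_j^{\,\xi},$$ $$[[\bar f_j^{\,\xi},\bar f_k^{\,\eta}],\bar b_l^{\,\epsilon}]=0,\qquad[\{\bar b_j^{\,\xi},\bar b_k^{\,\eta}\},\bar f_l^{\,\epsilon}]=0,$$ $$\{\{\bar f_j^{\,\xi},\bar b_k^{\,\eta}\},\bar f_l^{\,\epsilon}\}=|\epsilon-\xi|\,\delta_{jl}\,\bar b_k^{\,\eta},\qquad[\{\bar f_j^{\,\xi},\bar b_k^{\,\eta}\},\bar b_l^{\,\epsilon}]=(\epsilon-\eta)\,\delta_{kl}\,\bar f_j^{\,\xi},$$ where $[\cdot,\cdot]$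 and $\{\cdot,\cdot\}$ both denote the graded bracket $[\![\cdot,\cdot]\!]$ (commutator or anticommutator according to the degrees). That is, there is an isomorphism of $\mathbb{Z}_2\times\mathbb{Z}_2$-graded Lie superalgebras, preserving degrees, from the algebra with these abstract generators and relations onto $\mathfrak{pso}(\infty|\infty)$ that sends each generator to the matrix $\bar c_i^{\,\pm}$ of the same name. -/

import Mathlib

set_option linter.unusedSimpArgs false

noncomputable section

namespace Parastatistics

/-! ### `ℤ₂ × ℤ₂`-graded Lie superalgebras over `ℂ` -/

/-- The grading group `ℤ₂ × ℤ₂`. -/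
abbrev Gr : Type := ZMod 2 × ZMod 2

/-- The sign `(-1)^{a · b}`, where `a · b = a₁ b₁ + a₂ b₂`. -/
def sgn (a b : Gr) : ℂ := (-1 : ℂ) ^ (a.1 * b.1 + a.2 * b.2).val

/-- A `ℤ₂ × ℤ₂`-graded Lie superalgebra over `ℂ`: a vector space with a direct sum decomposition
indexed by `ℤ₂ × ℤ₂` and a bilinear bracket which respects the grading and satisfies graded
symmetry and the graded Jacobi identity on homogeneous elements. -/
class GradedLieSuperalgebra (L : Type*) [AddCommGroup L] [Module ℂ L] where
  grade : Gr → Submodule ℂ L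
  isInternal : DirectSum.IsInternal grade
  bracket : L →ₗ[ℂ] L →ₗ[ℂ] L
  bracket_mem : ∀ (a b : Gr) (x y : L), x ∈ grade a → y ∈ grade b → bracket x y ∈ grade (a + b)
  bracket_symm : ∀ (a b : Gr) (x y : L), x ∈ grade a → y ∈ grade b →
    bracket x y = -(sgn a b • bracket y x)
  jacobi : ∀ (a b c : Gr) (x y z : L), x ∈ grade a → y ∈ grade b → z ∈ grade c →
    bracket x (bracket y z) = bracket (bracket x y) z + sgn a b • bracket y (bracket x z)

/-- Isomorphisms of `ℤ₂ × ℤ₂`-graded Lie superalgebras: linear bijections that preserve the bracket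
and the degree. -/
structure GradedLieEquiv (L M : Type*) [AddCommGroup L] [Module ℂ L] [GradedLieSuperalgebra L]
    [AddCommGroup M] [Module ℂ M] [GradedLieSuperalgebra M] extends L ≃ₗ[ℂ] M where
  map_bracket : ∀ x y : L, toFun (GradedLieSuperalgebra.bracket x y) =
    GradedLieSuperalgebra.bracket (toFun x) (toFun y)
  map_grade : ∀ (a : Gr) (x : L),
    toFun x ∈ GradedLieSuperalgebra.grade (L := M) a ↔ x ∈ GradedLieSuperalgebra.grade (L := L) a

theorem sgn_comm (a b : Gr) : sgn a b = sgn b a := by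
  simp only [sgn, mul_comm]

theorem sgn_cases (a b : Gr) : sgn a b = 1 ∨ sgn a b = -1 := by
  unfold sgn
  exact neg_one_pow_eq_or ℂ _

theorem sgn_mul_self (a b : Gr) : sgn a b * sgn a b = 1 := by
  rcases sgn_cases a b with h | h <;> rw [h] <;> norm_num

theorem neg_one_pow_val_add (u v : ZMod 2) :
    (-1 : ℂ) ^ (u + v).val = (-1) ^ u.val * (-1) ^ v.val := by
  revert u v
  have h2 : ∀ u : ZMod 2, u = 0 ∨ u = 1 := by decide
  intro u v
  have h11 : (1 + 1 : ZMod 2) = 0 := by decide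
  rcases h2 u with rfl | rfl <;> rcases h2 v with rfl | rfl <;> simp [ZMod.val_one, h11]

theorem sgn_add_right (a b c : Gr) : sgn a (b + c) = sgn a b * sgn a c := by
  unfold sgn
  rw [← neg_one_pow_val_add]
  congr 2
  simp only [Prod.fst_add, Prod.snd_add]
  ring

theorem sgn_add_left (a b c : Gr) : sgn (a + b) c = sgn a c * sgn b c := by
  rw [sgn_comm, sgn_add_right, sgn_comm c a, sgn_comm c b]

theorem isInternal_of_proj {L : Type*} [AddCommGroup L] [Module ℂ L] (G : Gr → Submodule ℂ L)
    (P : Gr → L →ₗ[ℂ] L) (h1 : ∀ a x, P a x ∈ G a) (h2 : ∀ a x, x ∈ G a → P a x = x)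
    (h3 : ∀ a b x, b ≠ a → x ∈ G b → P a x = 0) (h4 : ∀ x, ∑ a, P a x = x) :
    DirectSum.IsInternal G := by
  have key : ∀ (b : Gr) (v : DirectSum Gr fun a => G a),
      P b (DirectSum.coeAddMonoidHom G v) = v b := by
    intro b v
    induction v using DirectSum.induction_on with
    | zero => simp
    | of a x =>
      rw [DirectSum.coeAddMonoidHom_of]
      by_cases hab : a = b
      · subst hab
        rw [h2 _ _ x.2, DirectSum.of_eq_same]
      · rw [h3 _ _ _ hab x.2, DirectSum.of_eq_of_ne _ _ _ (Ne.symm hab)]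
        simp
    | add v w hv hw => simp [hv, hw]
  constructor
  · intro v w hvw
    ext b
    rw [← key, ← key, hvw]
  · intro x
    refine ⟨∑ a, DirectSum.of (fun a => G a) a ⟨P a x, h1 a x⟩, ?_⟩
    rw [map_sum]
    simp only [DirectSum.coeAddMonoidHom_of]
    exact h4 x

/-! ### `ℤ₂ × ℤ₂`-graded Lie superalgebras defined by generators and relations -/

section Presentations

variable {X : Type*} (deg : X → Gr)

/-- The degree of a non-associative word in the generators. -/
def wordDeg : FreeMagma X → Gr
  | .of x => deg x
  | .mul u v => wordDeg u + wordDeg v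

/-- The homogeneous component of degree `a` of the free non-associative algebra: the span of the
words of degree `a`. -/
def freeGrade (a : Gr) : Submodule ℂ (FreeNonUnitalNonAssocAlgebra ℂ X) :=
  Submodule.span ℂ {w | ∃ u : FreeMagma X, wordDeg deg u = a ∧ w = MonoidAlgebra.single u 1}

/-- Membership in the two-sided ideal of the free non-associative algebra (whose product is the
formal bracket) generated by graded symmetry, the graded Jacobi identity and the set `R`. -/
inductive InIdeal (R : Set (FreeNonUnitalNonAssocAlgebra ℂ X)) :
    FreeNonUnitalNonAssocAlgebra ℂ X → Prop
  | rel (r) : r ∈ R → InIdeal R r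
  | symm (a b : Gr) (x y) : x ∈ freeGrade deg a → y ∈ freeGrade deg b →
      InIdeal R (x * y + sgn a b • (y * x))
  | jacobi (a b c : Gr) (x y z) : x ∈ freeGrade deg a → y ∈ freeGrade deg b →
      z ∈ freeGrade deg c →
      InIdeal R (x * (y * z) - ((x * y) * z + sgn a b • (y * (x * z))))
  | zero : InIdeal R 0
  | add (x y) : InIdeal R x → InIdeal R y → InIdeal R (x + y)
  | smul (t : ℂ) (x) : InIdeal R x → InIdeal R (t • x)
  | mul_left (y x) : InIdeal R x → InIdeal R (y * x)
  | mul_right (x y) : InIdeal R x → InIdeal R (x * y)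

/-- The ideal described by `InIdeal`. -/
def ideal (R : Set (FreeNonUnitalNonAssocAlgebra ℂ X)) :
    Submodule ℂ (FreeNonUnitalNonAssocAlgebra ℂ X) where
  carrier := {x | InIdeal deg R x}
  zero_mem' := .zero
  add_mem' := fun hx hy => .add _ _ hx hy
  smul_mem' := fun t _ hx => .smul t _ hx

/-- The projection of the free non-associative algebra onto its component of degree `a`. -/
def freeProj (a : Gr) :
    FreeNonUnitalNonAssocAlgebra ℂ X →ₗ[ℂ] FreeNonUnitalNonAssocAlgebra ℂ X :=
  (Finsupp.linearCombination ℂ fun u : FreeMagma X =>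
    if wordDeg deg u = a then (MonoidAlgebra.single u 1 : FreeNonUnitalNonAssocAlgebra ℂ X)
    else 0) ∘ₗ (MonoidAlgebra.coeffLinearEquiv ℂ).toLinearMap

theorem freeProj_single (a : Gr) (u : FreeMagma X) (t : ℂ) :
    freeProj deg a (MonoidAlgebra.single u t) =
      if wordDeg deg u = a then MonoidAlgebra.single u t else 0 := by
  simp only [freeProj, LinearMap.comp_apply]
  have : (MonoidAlgebra.coeffLinearEquiv (S := ℂ) (M := FreeMagma X) ℂ).toLinearMap
      (MonoidAlgebra.single u t) = Finsupp.single u t := rfl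
  rw [this, Finsupp.linearCombination_single]
  split_ifs
  · simp
  · simp

theorem freeProj_mem (a : Gr) (x : FreeNonUnitalNonAssocAlgebra ℂ X) :
    freeProj deg a x ∈ freeGrade deg a := by
  induction x using MonoidAlgebra.induction_linear with
  | zero => simp
  | add x y hx hy => rw [map_add]; exact add_mem hx hy
  | single u t =>
    rw [freeProj_single]
    split_ifs with h
    · have : (MonoidAlgebra.single u t : FreeNonUnitalNonAssocAlgebra ℂ X) =
          t • MonoidAlgebra.single u 1 := by simp
      rw [this]
      exact Submodule.smul_mem _ _ (Submodule.subset_span ⟨u, h, rfl⟩)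
    · exact zero_mem _

theorem freeProj_of_mem (a b : Gr) (x : FreeNonUnitalNonAssocAlgebra ℂ X)
    (hx : x ∈ freeGrade deg b) : freeProj deg a x = if b = a then x else 0 := by
  induction hx using Submodule.span_induction with
  | mem x h =>
    obtain ⟨u, hu, rfl⟩ := h
    rw [freeProj_single, hu]
  | zero => simp
  | add x y _ _ hx hy =>
    rw [map_add, hx, hy]
    split_ifs <;> simp
  | smul t x _ hx =>
    rw [map_smul, hx]
    split_ifs <;> simp

theorem sum_freeProj (x : FreeNonUnitalNonAssocAlgebra ℂ X) : ∑ a, freeProj deg a x = x := by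
  induction x using MonoidAlgebra.induction_linear with
  | zero => simp
  | add x y hx hy => simp only [map_add, Finset.sum_add_distrib, hx, hy]
  | single u t => simp [freeProj_single]

theorem mul_mem_freeGrade (a b : Gr) (x y : FreeNonUnitalNonAssocAlgebra ℂ X)
    (hx : x ∈ freeGrade deg a) (hy : y ∈ freeGrade deg b) : x * y ∈ freeGrade deg (a + b) := by
  induction hx using Submodule.span_induction with
  | zero => simp
  | add x x' _ _ hx hx' => rw [add_mul]; exact add_mem hx hx'
  | smul t x _ hx => rw [smul_mul_assoc]; exact Submodule.smul_mem _ _ hx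
  | mem x h =>
    obtain ⟨u, hu, rfl⟩ := h
    induction hy using Submodule.span_induction with
    | zero => simp
    | add x x' _ _ hx hx' => rw [mul_add]; exact add_mem hx hx'
    | smul t x _ hx => rw [mul_smul_comm]; exact Submodule.smul_mem _ _ hx
    | mem y h =>
      obtain ⟨v, hv, rfl⟩ := h
      refine Submodule.subset_span ⟨u * v, ?_, ?_⟩
      · rw [← hu, ← hv]; rfl
      · simp

theorem of_mem_freeGrade (x : X) :
    FreeNonUnitalNonAssocAlgebra.of ℂ x ∈ freeGrade deg (deg x) :=
  Submodule.subset_span ⟨FreeMagma.of x, rfl, rfl⟩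

theorem freeProj_mul (a : Gr) (x y : FreeNonUnitalNonAssocAlgebra ℂ X) :
    freeProj deg a (x * y) = ∑ b, freeProj deg (a - b) x * freeProj deg b y := by
  have hx : x * y = ∑ b, ∑ c, freeProj deg c x * freeProj deg b y := by
    conv_lhs => rw [← sum_freeProj deg x, ← sum_freeProj deg y, Finset.mul_sum]
    simp only [Finset.sum_mul]
  rw [hx, map_sum]
  refine Finset.sum_congr rfl fun b _ => ?_
  rw [map_sum, Finset.sum_eq_single (a - b)]
  · rw [freeProj_of_mem deg a (a - b + b) _
      (mul_mem_freeGrade deg _ _ _ _ (freeProj_mem deg _ _) (freeProj_mem deg _ _))]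
    simp
  · intro c _ hc
    rw [freeProj_of_mem deg a (c + b) _
      (mul_mem_freeGrade deg _ _ _ _ (freeProj_mem deg _ _) (freeProj_mem deg _ _)), if_neg]
    intro h
    exact hc (by rw [← h]; simp)
  · simp

theorem freeProj_mem_ideal (R : Set (FreeNonUnitalNonAssocAlgebra ℂ X))
    (hR : ∀ r ∈ R, ∃ a, r ∈ freeGrade deg a) (x : FreeNonUnitalNonAssocAlgebra ℂ X)
    (hx : x ∈ ideal deg R) (a : Gr) : freeProj deg a x ∈ ideal deg R := by
  have homog : ∀ (b : Gr) (x), x ∈ freeGrade deg b → x ∈ ideal deg R →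
      ∀ a, freeProj deg a x ∈ ideal deg R := by
    intro b x hb hx a
    rw [freeProj_of_mem deg a b x hb]
    split_ifs
    · exact hx
    · exact zero_mem _
  change InIdeal deg R x at hx
  induction hx generalizing a with
  | rel r hr =>
    obtain ⟨b, hb⟩ := hR r hr
    exact homog b r hb (.rel r hr) a
  | symm b c x y hx hy =>
    refine homog (b + c) _ (add_mem (mul_mem_freeGrade deg _ _ _ _ hx hy)
      (Submodule.smul_mem _ _ ?_)) (.symm b c x y hx hy) a
    rw [add_comm b c]
    exact mul_mem_freeGrade deg _ _ _ _ hy hx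
  | jacobi b c d x y z hx hy hz =>
    refine homog (b + (c + d)) _ (sub_mem ?_ (add_mem ?_ (Submodule.smul_mem _ _ ?_)))
      (.jacobi b c d x y z hx hy hz) a
    · exact mul_mem_freeGrade deg _ _ _ _ hx (mul_mem_freeGrade deg _ _ _ _ hy hz)
    · rw [← add_assoc]
      exact mul_mem_freeGrade deg _ _ _ _ (mul_mem_freeGrade deg _ _ _ _ hx hy) hz
    · rw [add_left_comm]
      exact mul_mem_freeGrade deg _ _ _ _ hy (mul_mem_freeGrade deg _ _ _ _ hx hz)
  | zero => simp
  | add x y _ _ hx hy => rw [map_add]; exact add_mem (hx a) (hy a)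
  | smul t x _ hx => rw [map_smul]; exact Submodule.smul_mem _ _ (hx a)
  | mul_left y x _ hx =>
    rw [freeProj_mul]
    exact sum_mem fun b _ => InIdeal.mul_left _ _ (hx b)
  | mul_right x y _ hx =>
    rw [freeProj_mul]
    exact sum_mem fun b _ => InIdeal.mul_right _ _ (hx (a - b))

end Presentations

/-- Data for defining a `ℤ₂ × ℤ₂`-graded Lie superalgebra by generators and relations: generators
with prescribed degrees, and homogeneous relators. A relator `r` stands for the relation `r = 0`;
it is a linear combination of iterated formal brackets of the generators, and the formal bracket is
the product of the free non-associative algebra. -/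
structure GradedPresentation where
  Gen : Type
  deg : Gen → Gr
  rels : Set (FreeNonUnitalNonAssocAlgebra ℂ Gen)
  homogeneous : ∀ r ∈ rels, ∃ a, r ∈ freeGrade deg a

namespace GradedPresentation

variable (P : GradedPresentation)

/-- The `ℤ₂ × ℤ₂`-graded Lie superalgebra defined by the generators and relations of `P`. -/
abbrev Algebra : Type :=
  FreeNonUnitalNonAssocAlgebra ℂ P.Gen ⧸ ideal P.deg P.rels

/-- The generators of the presented algebra. -/
def gen (x : P.Gen) : P.Algebra :=
  Submodule.Quotient.mk (FreeNonUnitalNonAssocAlgebra.of ℂ x)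

/-- The bracket of the presented algebra, induced by the product of the free algebra. -/
def bracket : P.Algebra →ₗ[ℂ] P.Algebra →ₗ[ℂ] P.Algebra :=
  (ideal P.deg P.rels).liftQ
    { toFun := fun x => (ideal P.deg P.rels).mapQ (ideal P.deg P.rels)
        (LinearMap.mulLeft ℂ x) (fun y hy => InIdeal.mul_left x y hy)
      map_add' := fun x x' => by
        refine Submodule.linearMap_qext _ (LinearMap.ext fun y => ?_)
        exact congrArg (ideal P.deg P.rels).mkQ (add_mul x x' y)
      map_smul' := fun t x => by
        refine Submodule.linearMap_qext _ (LinearMap.ext fun y => ?_)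
        exact congrArg (ideal P.deg P.rels).mkQ (smul_mul_assoc t x y) }
    (fun x hx => by
      refine Submodule.linearMap_qext _ (LinearMap.ext fun y => ?_)
      exact (Submodule.Quotient.mk_eq_zero (ideal P.deg P.rels)).2 (InIdeal.mul_right x y hx))

theorem bracket_mk (x y : FreeNonUnitalNonAssocAlgebra ℂ P.Gen) :
    P.bracket (Submodule.Quotient.mk x) (Submodule.Quotient.mk y) =
      Submodule.Quotient.mk (x * y) := rfl

instance : GradedLieSuperalgebra P.Algebra where
  grade a := (freeGrade P.deg a).map (ideal P.deg P.rels).mkQ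
  isInternal := by
    refine isInternal_of_proj _ (fun a => (ideal P.deg P.rels).mapQ (ideal P.deg P.rels)
      (freeProj P.deg a) (fun x hx => freeProj_mem_ideal P.deg P.rels P.homogeneous x hx a))
      ?_ ?_ ?_ ?_
    · intro a x
      obtain ⟨x, rfl⟩ := Submodule.mkQ_surjective _ x
      exact Submodule.mem_map_of_mem (freeProj_mem P.deg a x)
    · rintro a _ ⟨x, hx, rfl⟩
      simp [freeProj_of_mem P.deg a a x hx]
    · rintro a b _ hab ⟨x, hx, rfl⟩
      simp [freeProj_of_mem P.deg a b x hx, hab]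
    · intro x
      obtain ⟨x, rfl⟩ := Submodule.mkQ_surjective _ x
      conv_rhs => rw [← sum_freeProj P.deg x]
      simp
  bracket := P.bracket
  bracket_mem := by
    rintro a b _ _ ⟨x, hx, rfl⟩ ⟨y, hy, rfl⟩
    exact Submodule.mem_map_of_mem (mul_mem_freeGrade P.deg a b x y hx hy)
  bracket_symm := by
    rintro a b _ _ ⟨x, hx, rfl⟩ ⟨y, hy, rfl⟩
    rw [eq_neg_iff_add_eq_zero]
    exact (Submodule.Quotient.mk_eq_zero _).2 (InIdeal.symm a b x y hx hy)
  jacobi := by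
    rintro a b c _ _ _ ⟨x, hx, rfl⟩ ⟨y, hy, rfl⟩ ⟨z, hz, rfl⟩
    rw [← sub_eq_zero]
    exact (Submodule.Quotient.mk_eq_zero _).2 (InIdeal.jacobi a b c x y z hx hy hz)

end GradedPresentation

/-! ### Parafermions and parabosons with relative paraboson relations -/

/-- The index set `ℤ* = ℤ \ {0}`. Negative indices belong to parafermions, positive indices to
parabosons. -/
abbrev ZStar : Type := {i : ℤ // i ≠ 0}

/-- The degree of `c_i^±`: `(1,1)` for a parafermion, `(1,0)` for a paraboson. -/
def cDeg (x : ZStar × ℤˣ) : Gr := if (x.1 : ℤ) < 0 then (1, 1) else (1, 0)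

/-- The formal generator `c_i^ξ`, where the sign `ξ` is a unit `±1` of `ℤ`. -/
def cFree (i : ZStar) (ξ : ℤˣ) : FreeNonUnitalNonAssocAlgebra ℂ (ZStar × ℤˣ) :=
  FreeNonUnitalNonAssocAlgebra.of ℂ (i, ξ)

/-- The Kronecker delta. -/
def delta (j k : ZStar) : ℂ := if j = k then 1 else 0

/-- The difference `ε - η` of two signs. -/
def diff (ε η : ℤˣ) : ℂ := (((ε : ℤ) - (η : ℤ) : ℤ) : ℂ)

/-- The absolute value `|ε - η|` of the difference of two signs. -/
def absDiff (ε η : ℤˣ) : ℂ := ((|(ε : ℤ) - (η : ℤ)| : ℤ) : ℂ)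

/-- The triple relations, each written as `left-hand side - right-hand side`. All brackets are
graded brackets, written as products; in terms of commutators and anticommutators they are
`[[f,f],f]`, `[{b,b},b]`, `[[f,f],b]`, `[{b,b},f]`, `{{f,b},f}` and `[{f,b},b]`. -/
inductive TripleRelator : FreeNonUnitalNonAssocAlgebra ℂ (ZStar × ℤˣ) → Prop
  | fff (j k l : ZStar) (ξ η ε : ℤˣ) (hj : (j : ℤ) < 0) (hk : (k : ℤ) < 0) (hl : (l : ℤ) < 0) :
      TripleRelator ((cFree j ξ * cFree k η) * cFree l ε -
        ((absDiff ε η * delta k l) • cFree j ξ - (absDiff ε ξ * delta j l) • cFree k η))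
  | bbb (j k l : ZStar) (ξ η ε : ℤˣ) (hj : 0 < (j : ℤ)) (hk : 0 < (k : ℤ)) (hl : 0 < (l : ℤ)) :
      TripleRelator ((cFree j ξ * cFree k η) * cFree l ε -
        ((diff ε ξ * delta j l) • cFree k η + (diff ε η * delta k l) • cFree j ξ))
  | ffb (j k l : ZStar) (ξ η ε : ℤˣ) (hj : (j : ℤ) < 0) (hk : (k : ℤ) < 0) (hl : 0 < (l : ℤ)) :
      TripleRelator ((cFree j ξ * cFree k η) * cFree l ε)
  | bbf (j k l : ZStar) (ξ η ε : ℤˣ) (hj : 0 < (j : ℤ)) (hk : 0 < (k : ℤ)) (hl : (l : ℤ) < 0) :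
      TripleRelator ((cFree j ξ * cFree k η) * cFree l ε)
  | fbf (j k l : ZStar) (ξ η ε : ℤˣ) (hj : (j : ℤ) < 0) (hk : 0 < (k : ℤ)) (hl : (l : ℤ) < 0) :
      TripleRelator ((cFree j ξ * cFree k η) * cFree l ε -
        (absDiff ε ξ * delta j l) • cFree k η)
  | fbb (j k l : ZStar) (ξ η ε : ℤˣ) (hj : (j : ℤ) < 0) (hk : 0 < (k : ℤ)) (hl : 0 < (l : ℤ)) :
      TripleRelator ((cFree j ξ * cFree k η) * cFree l ε -
        (diff ε η * delta k l) • cFree j ξ)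

theorem cFree_mem_of_neg (i : ZStar) (ξ : ℤˣ) (hi : (i : ℤ) < 0) :
    cFree i ξ ∈ freeGrade cDeg (1, 1) := by
  have h := of_mem_freeGrade cDeg (i, ξ)
  rwa [cDeg, if_pos hi] at h

theorem cFree_mem_of_pos (i : ZStar) (ξ : ℤˣ) (hi : 0 < (i : ℤ)) :
    cFree i ξ ∈ freeGrade cDeg (1, 0) := by
  have h := of_mem_freeGrade cDeg (i, ξ)
  rwa [cDeg, if_neg hi.not_gt] at h

theorem tripleRelator_homogeneous (r : FreeNonUnitalNonAssocAlgebra ℂ (ZStar × ℤˣ))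
    (hr : TripleRelator r) : ∃ a, r ∈ freeGrade cDeg a := by
  have tri : ∀ (a b c d : Gr) (x y z : FreeNonUnitalNonAssocAlgebra ℂ (ZStar × ℤˣ)),
      a + b + c = d → x ∈ freeGrade cDeg a → y ∈ freeGrade cDeg b → z ∈ freeGrade cDeg c →
      (x * y) * z ∈ freeGrade cDeg d := by
    rintro a b c d x y z rfl hx hy hz
    exact mul_mem_freeGrade _ _ _ _ _ (mul_mem_freeGrade _ _ _ _ _ hx hy) hz
  cases hr with
  | fff j k l ξ η ε hj hk hl =>
    exact ⟨(1, 1), sub_mem (tri (1, 1) (1, 1) (1, 1) (1, 1) _ _ _ (by decide)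
      (cFree_mem_of_neg _ _ hj) (cFree_mem_of_neg _ _ hk) (cFree_mem_of_neg _ _ hl))
      (sub_mem (Submodule.smul_mem _ _ (cFree_mem_of_neg _ _ hj))
        (Submodule.smul_mem _ _ (cFree_mem_of_neg _ _ hk)))⟩
  | bbb j k l ξ η ε hj hk hl =>
    exact ⟨(1, 0), sub_mem (tri (1, 0) (1, 0) (1, 0) (1, 0) _ _ _ (by decide)
      (cFree_mem_of_pos _ _ hj) (cFree_mem_of_pos _ _ hk) (cFree_mem_of_pos _ _ hl))
      (add_mem (Submodule.smul_mem _ _ (cFree_mem_of_pos _ _ hk))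
        (Submodule.smul_mem _ _ (cFree_mem_of_pos _ _ hj)))⟩
  | ffb j k l ξ η ε hj hk hl =>
    exact ⟨(1, 0), tri (1, 1) (1, 1) (1, 0) (1, 0) _ _ _ (by decide)
      (cFree_mem_of_neg _ _ hj) (cFree_mem_of_neg _ _ hk) (cFree_mem_of_pos _ _ hl)⟩
  | bbf j k l ξ η ε hj hk hl =>
    exact ⟨(1, 1), tri (1, 0) (1, 0) (1, 1) (1, 1) _ _ _ (by decide)
      (cFree_mem_of_pos _ _ hj) (cFree_mem_of_pos _ _ hk) (cFree_mem_of_neg _ _ hl)⟩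
  | fbf j k l ξ η ε hj hk hl =>
    exact ⟨(1, 0), sub_mem (tri (1, 1) (1, 0) (1, 1) (1, 0) _ _ _ (by decide)
      (cFree_mem_of_neg _ _ hj) (cFree_mem_of_pos _ _ hk) (cFree_mem_of_neg _ _ hl))
      (Submodule.smul_mem _ _ (cFree_mem_of_pos _ _ hk))⟩
  | fbb j k l ξ η ε hj hk hl =>
    exact ⟨(1, 1), sub_mem (tri (1, 1) (1, 0) (1, 0) (1, 1) _ _ _ (by decide)
      (cFree_mem_of_neg _ _ hj) (cFree_mem_of_pos _ _ hk) (cFree_mem_of_pos _ _ hl))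
      (Submodule.smul_mem _ _ (cFree_mem_of_neg _ _ hj))⟩

/-- The presentation by infinitely many parafermions and parabosons, subject to the triple
relations with relative paraboson relations. -/
def parastatistics : GradedPresentation where
  Gen := ZStar × ℤˣ
  deg := cDeg
  rels := {r | TripleRelator r}
  homogeneous := tripleRelator_homogeneous

/-! ### The matrix algebra `pso(∞|∞)` -/

/-- The infinite square matrices have scalar rows and columns labelled by `ℤ`. For `i ≠ 0` the
`i`-th block consists of the scalar indices `2i - 1, 2i` if `i > 0`, and `2i, 2i + 1` if `i < 0`;
the block `0` consists of the scalar index `0`. -/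
def blockIndex (i : ℤ) (a : Fin 2) : ℤ := if i < 0 then 2 * i + (a : ℤ) else 2 * i - 1 + (a : ℤ)

/-- The `2 × 2` block `Y_{ij}`, for `i, j ≠ 0`. -/
def block (Y : Matrix ℤ ℤ ℂ) (i j : ℤ) : Matrix (Fin 2) (Fin 2) ℂ :=
  Y.submatrix (blockIndex i) (blockIndex j)

/-- The `1 × 2` block `Y_{0j}`, for `j ≠ 0`. -/
def rowBlock (Y : Matrix ℤ ℤ ℂ) (j : ℤ) : Matrix (Fin 1) (Fin 2) ℂ :=
  Y.submatrix (fun _ => 0) (blockIndex j)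

/-- The `2 × 1` block `Y_{i0}`, for `i ≠ 0`. -/
def colBlock (Y : Matrix ℤ ℤ ℂ) (i : ℤ) : Matrix (Fin 2) (Fin 1) ℂ :=
  Y.submatrix (blockIndex i) (fun _ => 0)

/-- The matrix `I`. -/
def matI : Matrix (Fin 2) (Fin 2) ℂ := !![0, 1; 1, 0]

/-- The matrix `J`. -/
def matJ : Matrix (Fin 2) (Fin 2) ℂ := !![0, 1; -1, 0]

open scoped Matrix in
/-- The conditions on an infinite matrix that define `pso(∞|∞)`. -/
structure IsPso (Y : Matrix ℤ ℤ ℂ) : Prop where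
  finite : {p : ℤ × ℤ | Y p.1 p.2 ≠ 0}.Finite
  zero_zero : Y 0 0 = 0
  neg_neg : ∀ i j : ℤ, 0 < i → 0 < j → matI * block Y (-i) (-j) + (block Y (-j) (-i))ᵀ * matI = 0
  pos_pos : ∀ i j : ℤ, 0 < i → 0 < j → matJ * block Y i j + (block Y j i)ᵀ * matJ = 0
  neg_pos : ∀ i j : ℤ, 0 < i → 0 < j → matI * block Y (-i) j + (block Y j (-i))ᵀ * matJ = 0
  zero_neg : ∀ j : ℤ, 0 < j → rowBlock Y (-j) + (colBlock Y (-j))ᵀ * matI = 0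
  zero_pos : ∀ j : ℤ, 0 < j → rowBlock Y j - (colBlock Y j)ᵀ * matJ = 0

/-- Degrees of the scalar rows and columns. -/
def rowDeg (p : ℤ) : Gr := if p < 0 then (0, 0) else if p = 0 then (1, 1) else (0, 1)

/-- The degree of the matrix position `(p, q)`: with rows and columns split into those of negative,
zero and positive index, the degrees of the positions are
```
(0,0) (1,1) (0,1)
(1,1) (0,0) (1,0)
(0,1) (1,0) (0,0)
```
(in `pso(∞|∞)` the entry at the centre vanishes). -/
def posDeg (p q : ℤ) : Gr := rowDeg p + rowDeg q

/-- The product of infinite matrices with finitely many nonzero entries. -/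
def finMul (X Y : Matrix ℤ ℤ ℂ) : Matrix ℤ ℤ ℂ := fun p q => ∑ᶠ r, X p r * Y r q

/-- The homogeneous component of degree `a` of a matrix. -/
def comp (a : Gr) (Y : Matrix ℤ ℤ ℂ) : Matrix ℤ ℤ ℂ := fun p q => if posDeg p q = a then Y p q else 0

/-- The bracket `⟦x, y⟧ = x y - (-1)^{a · b} y x` for `x`, `y` homogeneous of degrees `a`, `b`,
extended by linearity. -/
def matBracket (X Y : Matrix ℤ ℤ ℂ) : Matrix ℤ ℤ ℂ :=
  ∑ a : Gr, ∑ b : Gr,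
    (finMul (comp a X) (comp b Y) - sgn a b • finMul (comp b Y) (comp a X))

/-! #### The defining conditions, entry by entry -/

/-- The scalar index that shares a block with `p`. -/
def sw (p : ℤ) : ℤ :=
  if p = 0 then 0 else if (0 < p ↔ p % 2 = 0) then p - 1 else p + 1

theorem sw_sw (p : ℤ) : sw (sw p) = p := by
  unfold sw; split_ifs <;> omega

theorem sw_neg (p : ℤ) : sw p < 0 ↔ p < 0 := by
  unfold sw; split_ifs <;> omega

theorem sw_zero (p : ℤ) : sw p = 0 ↔ p = 0 := by
  unfold sw; split_ifs <;> omega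

theorem sw_pos (p : ℤ) : 0 < sw p ↔ 0 < p := by
  unfold sw; split_ifs <;> omega

/-- The permutation of the scalar indices given by `sw`. -/
def swEquiv : ℤ ≃ ℤ := ⟨sw, sw, sw_sw, sw_sw⟩

/-- The sign `-1` at the second index of a positive block, and `1` elsewhere. -/
def sg (p : ℤ) : ℂ := if 0 < p ∧ p % 2 = 0 then -1 else 1

theorem sg_mul_self (p : ℤ) : sg p * sg p = 1 := by
  unfold sg; split_ifs <;> norm_num

/-- A sign that depends only on the blocks. -/
def lam (p q : ℤ) : ℂ := if (p < 0 ∧ 0 < q) ∨ (0 < p ∧ q = 0) then -1 else 1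

theorem lam_sw_left (p q : ℤ) : lam (sw p) q = lam p q := by
  simp only [lam, sw_neg, sw_pos]

theorem lam_sw_right (p q : ℤ) : lam p (sw q) = lam p q := by
  simp only [lam, sw_zero, sw_pos]

theorem rowDeg_sw (p : ℤ) : rowDeg (sw p) = rowDeg p := by
  simp only [rowDeg, sw_neg, sw_zero]

theorem posDeg_comm (p q : ℤ) : posDeg p q = posDeg q p := add_comm _ _

theorem posDeg_sw (p q : ℤ) : posDeg (sw q) (sw p) = posDeg p q := by
  simp only [posDeg, rowDeg_sw, add_comm]

theorem posDeg_add (p q r : ℤ) : posDeg p r + posDeg r q = posDeg p q := by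
  have h : ∀ a : Gr, a + a = 0 := by decide
  simp only [posDeg]
  rw [add_assoc, ← add_assoc (rowDeg r), h, zero_add]

theorem lam_mul (p q r : ℤ) :
    lam p r * lam r q = sgn (posDeg p r) (posDeg r q) * lam p q := by
  have h11 : (1 + 1 : ZMod 2) = 0 := by decide
  rcases lt_trichotomy p 0 with hp | rfl | hp <;> rcases lt_trichotomy q 0 with hq | rfl | hq <;>
    rcases lt_trichotomy r 0 with hr | rfl | hr <;>
    simp [lam, posDeg, rowDeg, sgn, ZMod.val_one, *, not_lt_of_gt, ne_of_gt, ne_of_lt]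

theorem index_cases (p : ℤ) : p = 0 ∨ (∃ i : ℤ, 0 < i ∧ ∃ a, p = blockIndex (-i) a) ∨
    (∃ i : ℤ, 0 < i ∧ ∃ a, p = blockIndex i a) := by
  rcases lt_trichotomy p 0 with hp | hp | hp
  · refine Or.inr (Or.inl ⟨-(p / 2), by omega, ?_⟩)
    rcases Int.emod_two_eq_zero_or_one p with h | h
    · exact ⟨0, by simp only [blockIndex]; rw [if_pos (by omega)]; simp; omega⟩
    · exact ⟨1, by simp only [blockIndex]; rw [if_pos (by omega)]; simp; omega⟩
  · exact Or.inl hp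
  · refine Or.inr (Or.inr ⟨(p + 1) / 2, by omega, ?_⟩)
    rcases Int.emod_two_eq_zero_or_one p with h | h
    · exact ⟨1, by simp only [blockIndex]; rw [if_neg (by omega)]; simp; omega⟩
    · exact ⟨0, by simp only [blockIndex]; rw [if_neg (by omega)]; simp; omega⟩

theorem blockIndex_neg {i : ℤ} (hi : 0 < i) : ∀ a : Fin 2, blockIndex (-i) a < 0 ∧
    sw (blockIndex (-i) a) = blockIndex (-i) (1 - a) ∧ sg (blockIndex (-i) a) = 1 := by
  have h : ∀ a : Fin 2, blockIndex (-i) a = 2 * (-i) + (a : ℤ) := fun a => by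
    rw [blockIndex, if_pos (by omega)]
  intro a
  fin_cases a <;> simp only [h, sw, sg] <;> simp <;> (refine ⟨?_, ?_, ?_⟩) <;> grind

theorem blockIndex_pos {i : ℤ} (hi : 0 < i) : ∀ a : Fin 2, 0 < blockIndex i a ∧
    sw (blockIndex i a) = blockIndex i (1 - a) ∧
    sg (blockIndex i a) = if a = 0 then 1 else -1 := by
  have h : ∀ a : Fin 2, blockIndex i a = 2 * i - 1 + (a : ℤ) := fun a => by
    rw [blockIndex, if_neg (by omega)]
  intro a
  fin_cases a <;> simp only [h, sw, sg] <;> simp <;> grind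

/-- The defining conditions of `pso(∞|∞)` in terms of matrix entries. -/
def EntryCond (Y : Matrix ℤ ℤ ℂ) : Prop :=
  ∀ p q, Y p q = -(lam p q * (sg p * sg q)) * Y (sw q) (sw p)

theorem matI_mul (M : Matrix (Fin 2) (Fin 2) ℂ) (a b : Fin 2) :
    (matI * M) a b = M (1 - a) b := by
  rw [Matrix.mul_apply, Fin.sum_univ_two]
  fin_cases a <;> simp [matI]

theorem matJ_mul (M : Matrix (Fin 2) (Fin 2) ℂ) (a b : Fin 2) :
    (matJ * M) a b = (if a = 0 then 1 else -1) * M (1 - a) b := by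
  rw [Matrix.mul_apply, Fin.sum_univ_two]
  fin_cases a <;> simp [matJ]

theorem mul_matI {n : ℕ} (M : Matrix (Fin n) (Fin 2) ℂ) (a : Fin n) (b : Fin 2) :
    (M * matI) a b = M a (1 - b) := by
  rw [Matrix.mul_apply, Fin.sum_univ_two]
  fin_cases b <;> simp [matI]

theorem mul_matJ {n : ℕ} (M : Matrix (Fin n) (Fin 2) ℂ) (a : Fin n) (b : Fin 2) :
    (M * matJ) a b = (if b = 0 then -1 else 1) * M a (1 - b) := by
  rw [Matrix.mul_apply, Fin.sum_univ_two]
  fin_cases b <;> simp [matJ]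

theorem IsPso.entryCond {Y : Matrix ℤ ℤ ℂ} (h : IsPso Y) : EntryCond Y := by
  have sw0 : sw 0 = 0 := by simp [sw]
  have sg0 : sg 0 = 1 := by simp [sg]
  intro p q
  rcases index_cases p with rfl | ⟨i, hi, a, rfl⟩ | ⟨i, hi, a, rfl⟩ <;>
    rcases index_cases q with rfl | ⟨j, hj, b, rfl⟩ | ⟨j, hj, b, rfl⟩
  · simp [h.zero_zero, sw0]
  · obtain ⟨b1, b2, b3⟩ := blockIndex_neg hj b
    have e := congrFun₂ (h.zero_neg j hj) 0 b
    rw [b2, b3, sw0, sg0]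
    simp only [lam, b1, b1.not_gt, lt_irrefl]
    fin_cases b <;>
      simp [rowBlock, colBlock, mul_matI] at e ⊢ <;> grind only
  · obtain ⟨b1, b2, b3⟩ := blockIndex_pos hj b
    have e := congrFun₂ (h.zero_pos j hj) 0 b
    rw [b2, b3, sw0, sg0]
    simp only [lam, b1, b1.not_gt, lt_irrefl]
    fin_cases b <;>
      simp [rowBlock, colBlock, mul_matJ] at e ⊢ <;> grind only
  · obtain ⟨a1, a2, a3⟩ := blockIndex_neg hi a
    have e := congrFun₂ (h.zero_neg i hi) 0 (1 - a)
    rw [a2, a3, sw0, sg0]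
    simp only [lam, a1, a1.not_gt, lt_irrefl]
    fin_cases a <;>
      simp [rowBlock, colBlock, mul_matI] at e ⊢ <;> grind only
  · obtain ⟨a1, a2, a3⟩ := blockIndex_neg hi a
    obtain ⟨b1, b2, b3⟩ := blockIndex_neg hj b
    have e := congrFun₂ (h.neg_neg i j hi hj) (1 - a) b
    rw [a2, a3, b2, b3]
    simp only [lam, a1, a1.not_gt, b1, b1.not_gt]
    fin_cases a <;> fin_cases b <;>
      simp [block, matI_mul, mul_matI] at e ⊢ <;> grind only
  · obtain ⟨a1, a2, a3⟩ := blockIndex_neg hi a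
    obtain ⟨b1, b2, b3⟩ := blockIndex_pos hj b
    have e := congrFun₂ (h.neg_pos i j hi hj) (1 - a) b
    rw [a2, a3, b2, b3]
    simp only [lam, a1, a1.not_gt, b1, b1.not_gt]
    fin_cases a <;> fin_cases b <;>
      simp [block, matI_mul, mul_matJ] at e ⊢ <;> grind only
  · obtain ⟨a1, a2, a3⟩ := blockIndex_pos hi a
    have e := congrFun₂ (h.zero_pos i hi) 0 (1 - a)
    rw [a2, a3, sw0, sg0]
    simp only [lam, a1, a1.not_gt, lt_irrefl]
    fin_cases a <;>
      simp [rowBlock, colBlock, mul_matJ] at e ⊢ <;> grind only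
  · obtain ⟨a1, a2, a3⟩ := blockIndex_pos hi a
    obtain ⟨b1, b2, b3⟩ := blockIndex_neg hj b
    have e := congrFun₂ (h.neg_pos j i hj hi) b (1 - a)
    rw [a2, a3, b2, b3]
    simp only [lam, a1, a1.not_gt, b1, b1.not_gt, b1.ne]
    fin_cases a <;> fin_cases b <;>
      simp [block, matI_mul, mul_matJ] at e ⊢ <;> grind only
  · obtain ⟨a1, a2, a3⟩ := blockIndex_pos hi a
    obtain ⟨b1, b2, b3⟩ := blockIndex_pos hj b
    have e := congrFun₂ (h.pos_pos i j hi hj) (1 - a) b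
    rw [a2, a3, b2, b3]
    simp only [lam, a1, a1.not_gt, b1, b1.not_gt, b1.ne']
    fin_cases a <;> fin_cases b <;>
      simp [block, matJ_mul, mul_matJ] at e ⊢ <;> grind only

theorem EntryCond.isPso {Y : Matrix ℤ ℤ ℂ} (h : EntryCond Y)
    (hf : {p : ℤ × ℤ | Y p.1 p.2 ≠ 0}.Finite) : IsPso Y where
  finite := hf
  zero_zero := by
    have e := h 0 0
    simp [sw, sg, lam] at e
    grind only
  neg_neg i j hi hj := by
    ext a b
    obtain ⟨a1, a2, a3⟩ := blockIndex_neg hi (1 - a)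
    obtain ⟨b1, b2, b3⟩ := blockIndex_neg hj b
    have e := h (blockIndex (-i) (1 - a)) (blockIndex (-j) b)
    rw [a2, a3, b2, b3] at e
    simp only [lam, a1, a1.not_gt, b1, b1.not_gt] at e
    fin_cases a <;> fin_cases b <;>
      simp [block, matI_mul, mul_matI] at e ⊢ <;> grind only
  pos_pos i j hi hj := by
    ext a b
    obtain ⟨a1, a2, a3⟩ := blockIndex_pos hi (1 - a)
    obtain ⟨b1, b2, b3⟩ := blockIndex_pos hj b
    have e := h (blockIndex i (1 - a)) (blockIndex j b)
    rw [a2, a3, b2, b3] at e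
    simp only [lam, a1, a1.not_gt, b1, b1.not_gt, b1.ne'] at e
    fin_cases a <;> fin_cases b <;>
      simp [block, matJ_mul, mul_matJ] at e ⊢ <;> grind only
  neg_pos i j hi hj := by
    ext a b
    obtain ⟨a1, a2, a3⟩ := blockIndex_neg hi (1 - a)
    obtain ⟨b1, b2, b3⟩ := blockIndex_pos hj b
    have e := h (blockIndex (-i) (1 - a)) (blockIndex j b)
    rw [a2, a3, b2, b3] at e
    simp only [lam, a1, a1.not_gt, b1, b1.not_gt] at e
    fin_cases a <;> fin_cases b <;>
      simp [block, matI_mul, mul_matJ] at e ⊢ <;> grind only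
  zero_neg j hj := by
    ext a b
    obtain ⟨b1, b2, b3⟩ := blockIndex_neg hj b
    have e := h 0 (blockIndex (-j) b)
    rw [b2, b3] at e
    simp only [lam, b1, b1.not_gt, lt_irrefl] at e
    fin_cases a; fin_cases b <;>
      simp [rowBlock, colBlock, mul_matI, sw, sg] at e ⊢ <;> grind only
  zero_pos j hj := by
    ext a b
    obtain ⟨b1, b2, b3⟩ := blockIndex_pos hj b
    have e := h 0 (blockIndex j b)
    rw [b2, b3] at e
    simp only [lam, b1, b1.not_gt, lt_irrefl] at e
    fin_cases a; fin_cases b <;>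
      simp [rowBlock, colBlock, mul_matJ, sw, sg] at e ⊢ <;> grind only

/-! #### Products of finitely supported matrices -/

/-- Matrices with finitely many nonzero entries. -/
def finMat : Submodule ℂ (Matrix ℤ ℤ ℂ) where
  carrier := {Y | {p : ℤ × ℤ | Y p.1 p.2 ≠ 0}.Finite}
  zero_mem' := by simp
  add_mem' := by
    intro X Y hX hY
    refine (Set.Finite.union hX hY).subset ?_
    intro p hp
    by_contra hcon
    simp only [Set.mem_union, Set.mem_ofPred_eq, not_or, not_not] at hcon
    exact hp (by rw [Matrix.add_apply, hcon.1, hcon.2, add_zero])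
  smul_mem' := by
    intro t X hX
    refine Set.Finite.subset hX ?_
    intro p hp hcon
    exact hp (by rw [Matrix.smul_apply, hcon, smul_zero])

theorem exists_finset {Y : Matrix ℤ ℤ ℂ} (hY : Y ∈ finMat) :
    ∃ s : Finset ℤ, ∀ p q, Y p q ≠ 0 → p ∈ s ∧ q ∈ s := by
  classical
  have hY' : {p : ℤ × ℤ | Y p.1 p.2 ≠ 0}.Finite := hY
  refine ⟨hY'.toFinset.image Prod.fst ∪ hY'.toFinset.image Prod.snd, fun p q h => ?_⟩
  have hm : (p, q) ∈ hY'.toFinset := by simpa using h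
  exact ⟨Finset.mem_union_left _ (Finset.mem_image_of_mem Prod.fst hm),
    Finset.mem_union_right _ (Finset.mem_image_of_mem Prod.snd hm)⟩

theorem finMul_eq_sum_left {X : Matrix ℤ ℤ ℂ} {s : Finset ℤ}
    (hs : ∀ p q, X p q ≠ 0 → p ∈ s ∧ q ∈ s) (Y : Matrix ℤ ℤ ℂ) (p q : ℤ) :
    finMul X Y p q = ∑ r ∈ s, X p r * Y r q :=
  finsum_eq_sum_of_support_subset _ fun r hr => (hs p r (left_ne_zero_of_mul hr)).2

theorem finMul_eq_sum_right {Y : Matrix ℤ ℤ ℂ} {s : Finset ℤ}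
    (hs : ∀ p q, Y p q ≠ 0 → p ∈ s ∧ q ∈ s) (X : Matrix ℤ ℤ ℂ) (p q : ℤ) :
    finMul X Y p q = ∑ r ∈ s, X p r * Y r q :=
  finsum_eq_sum_of_support_subset _ fun r hr => (hs r q (right_ne_zero_of_mul hr)).1

theorem finMul_mem {X Y : Matrix ℤ ℤ ℂ} (hX : X ∈ finMat) (hY : Y ∈ finMat) :
    finMul X Y ∈ finMat := by
  obtain ⟨s, hs⟩ := exists_finset hX
  obtain ⟨t, ht⟩ := exists_finset hY
  refine Set.Finite.subset (s ×ˢ t).finite_toSet ?_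
  rintro ⟨p, q⟩ hpq
  simp only [Set.mem_ofPred_eq, finMul_eq_sum_left hs] at hpq
  obtain ⟨r, -, hr⟩ := Finset.exists_ne_zero_of_sum_ne_zero hpq
  simp only [Finset.coe_product, Set.mem_prod, Finset.mem_coe]
  exact ⟨(hs p r (left_ne_zero_of_mul hr)).1, (ht r q (right_ne_zero_of_mul hr)).2⟩

theorem finMul_add {X : Matrix ℤ ℤ ℂ} (hX : X ∈ finMat) (Y Z : Matrix ℤ ℤ ℂ) :
    finMul X (Y + Z) = finMul X Y + finMul X Z := by
  obtain ⟨s, hs⟩ := exists_finset hX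
  ext p q
  simp only [finMul_eq_sum_left hs, Matrix.add_apply, mul_add, Finset.sum_add_distrib]

theorem add_finMul {Z : Matrix ℤ ℤ ℂ} (hZ : Z ∈ finMat) (X Y : Matrix ℤ ℤ ℂ) :
    finMul (X + Y) Z = finMul X Z + finMul Y Z := by
  obtain ⟨s, hs⟩ := exists_finset hZ
  ext p q
  simp only [finMul_eq_sum_right hs, Matrix.add_apply, add_mul, Finset.sum_add_distrib]

theorem finMul_smul {X : Matrix ℤ ℤ ℂ} (hX : X ∈ finMat) (t : ℂ) (Y : Matrix ℤ ℤ ℂ) :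
    finMul X (t • Y) = t • finMul X Y := by
  obtain ⟨s, hs⟩ := exists_finset hX
  ext p q
  simp only [finMul_eq_sum_left hs, Matrix.smul_apply, smul_eq_mul, Finset.mul_sum]
  exact Finset.sum_congr rfl fun r _ => by ring

theorem smul_finMul {Z : Matrix ℤ ℤ ℂ} (hZ : Z ∈ finMat) (t : ℂ) (X : Matrix ℤ ℤ ℂ) :
    finMul (t • X) Z = t • finMul X Z := by
  obtain ⟨s, hs⟩ := exists_finset hZ
  ext p q
  simp only [finMul_eq_sum_right hs, Matrix.smul_apply, smul_eq_mul, Finset.mul_sum]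
  exact Finset.sum_congr rfl fun r _ => by ring

theorem finMul_sub {X : Matrix ℤ ℤ ℂ} (hX : X ∈ finMat) (Y Z : Matrix ℤ ℤ ℂ) :
    finMul X (Y - Z) = finMul X Y - finMul X Z := by
  rw [sub_eq_add_neg, ← neg_one_smul ℂ Z, finMul_add hX, finMul_smul hX, neg_one_smul,
    ← sub_eq_add_neg]

theorem sub_finMul {Z : Matrix ℤ ℤ ℂ} (hZ : Z ∈ finMat) (X Y : Matrix ℤ ℤ ℂ) :
    finMul (X - Y) Z = finMul X Z - finMul Y Z := by
  rw [sub_eq_add_neg, ← neg_one_smul ℂ Y, add_finMul hZ, smul_finMul hZ, neg_one_smul,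
    ← sub_eq_add_neg]

theorem finMul_zero (X : Matrix ℤ ℤ ℂ) : finMul X 0 = 0 := by
  ext p q
  simp [finMul]

theorem zero_finMul (X : Matrix ℤ ℤ ℂ) : finMul 0 X = 0 := by
  ext p q
  simp [finMul]

theorem finMul_assoc {X Z : Matrix ℤ ℤ ℂ} (hX : X ∈ finMat) (hZ : Z ∈ finMat)
    (Y : Matrix ℤ ℤ ℂ) : finMul (finMul X Y) Z = finMul X (finMul Y Z) := by
  obtain ⟨s, hs⟩ := exists_finset hX
  obtain ⟨t, ht⟩ := exists_finset hZ
  ext p q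
  simp only [finMul_eq_sum_left hs, finMul_eq_sum_right ht, Finset.mul_sum, Finset.sum_mul]
  rw [Finset.sum_comm]
  exact Finset.sum_congr rfl fun r _ => Finset.sum_congr rfl fun u _ => by ring

/-- Homogeneous matrices of degree `a`. -/
def IsHom (a : Gr) (Y : Matrix ℤ ℤ ℂ) : Prop := ∀ p q, Y p q ≠ 0 → posDeg p q = a

theorem comp_isHom (a : Gr) (Y : Matrix ℤ ℤ ℂ) : IsHom a (comp a Y) := by
  intro p q h
  by_contra hcon
  exact h (if_neg hcon)

theorem comp_of_isHom {b : Gr} {Y : Matrix ℤ ℤ ℂ} (h : IsHom b Y) (a : Gr) :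
    comp a Y = if b = a then Y else 0 := by
  ext p q
  by_cases h0 : Y p q = 0
  · split_ifs <;> simp [comp, h0]
  · simp only [comp, h p q h0]
    split_ifs <;> rfl

theorem sum_comp (Y : Matrix ℤ ℤ ℂ) : ∑ a, comp a Y = Y := by
  ext p q
  simp only [Matrix.sum_apply, comp, Finset.sum_ite_eq, Finset.mem_univ, if_true]

theorem comp_mem (a : Gr) {Y : Matrix ℤ ℤ ℂ} (hY : Y ∈ finMat) : comp a Y ∈ finMat := by
  refine Set.Finite.subset hY ?_
  intro p hp hcon
  exact hp (by simp only [comp, hcon, ite_self])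

theorem comp_add (a : Gr) (X Y : Matrix ℤ ℤ ℂ) : comp a (X + Y) = comp a X + comp a Y := by
  ext p q
  simp only [comp, Matrix.add_apply]
  split_ifs <;> simp

theorem comp_smul (a : Gr) (t : ℂ) (X : Matrix ℤ ℤ ℂ) : comp a (t • X) = t • comp a X := by
  ext p q
  simp only [comp, Matrix.smul_apply]
  split_ifs <;> simp

/-- The bracket `x y - (-1)^{a · b} y x`. -/
def homBracket (a b : Gr) (X Y : Matrix ℤ ℤ ℂ) : Matrix ℤ ℤ ℂ :=
  finMul X Y - sgn a b • finMul Y X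

theorem matBracket_eq (X Y : Matrix ℤ ℤ ℂ) :
    matBracket X Y = ∑ a : Gr, ∑ b : Gr, homBracket a b (comp a X) (comp b Y) := rfl

theorem matBracket_of_isHom {a b : Gr} {X Y : Matrix ℤ ℤ ℂ} (hX : IsHom a X) (hY : IsHom b Y) :
    matBracket X Y = homBracket a b X Y := by
  rw [matBracket_eq, Finset.sum_eq_single a, Finset.sum_eq_single b]
  · rw [comp_of_isHom hX, comp_of_isHom hY, if_pos rfl, if_pos rfl]
  · intro c _ hc
    rw [comp_of_isHom hY, if_neg hc.symm]
    simp [homBracket, finMul_zero, zero_finMul]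
  · simp
  · intro c _ hc
    refine Finset.sum_eq_zero fun d _ => ?_
    rw [comp_of_isHom hX, if_neg hc.symm]
    simp [homBracket, finMul_zero, zero_finMul]
  · simp

theorem homBracket_add {a b : Gr} {X : Matrix ℤ ℤ ℂ} (hX : X ∈ finMat) (Y Z : Matrix ℤ ℤ ℂ) :
    homBracket a b X (Y + Z) = homBracket a b X Y + homBracket a b X Z := by
  simp only [homBracket, finMul_add hX, add_finMul hX]
  module

theorem add_homBracket {a b : Gr} {Z : Matrix ℤ ℤ ℂ} (hZ : Z ∈ finMat) (X Y : Matrix ℤ ℤ ℂ) :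
    homBracket a b (X + Y) Z = homBracket a b X Z + homBracket a b Y Z := by
  simp only [homBracket, finMul_add hZ, add_finMul hZ]
  module

theorem homBracket_smul {a b : Gr} {X : Matrix ℤ ℤ ℂ} (hX : X ∈ finMat) (t : ℂ)
    (Y : Matrix ℤ ℤ ℂ) : homBracket a b X (t • Y) = t • homBracket a b X Y := by
  simp only [homBracket, finMul_smul hX, smul_finMul hX]
  module

theorem smul_homBracket {a b : Gr} {Z : Matrix ℤ ℤ ℂ} (hZ : Z ∈ finMat) (t : ℂ)
    (X : Matrix ℤ ℤ ℂ) : homBracket a b (t • X) Z = t • homBracket a b X Z := by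
  simp only [homBracket, finMul_smul hZ, smul_finMul hZ]
  module

theorem homBracket_mem (a b : Gr) {X Y : Matrix ℤ ℤ ℂ} (hX : X ∈ finMat) (hY : Y ∈ finMat) :
    homBracket a b X Y ∈ finMat :=
  sub_mem (finMul_mem hX hY) (Submodule.smul_mem _ _ (finMul_mem hY hX))

theorem finMul_isHom {a b : Gr} {X Y : Matrix ℤ ℤ ℂ} (hX : IsHom a X) (hY : IsHom b Y) :
    IsHom (a + b) (finMul X Y) := by
  intro p q h
  obtain ⟨r, hr⟩ : ∃ r, X p r * Y r q ≠ 0 := by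
    by_contra! hcon
    exact h (by simp [finMul, hcon])
  rw [← hX p r (left_ne_zero_of_mul hr), ← hY r q (right_ne_zero_of_mul hr), posDeg_add]

theorem homBracket_isHom {a b : Gr} {X Y : Matrix ℤ ℤ ℂ} (hX : IsHom a X) (hY : IsHom b Y) :
    IsHom (a + b) (homBracket a b X Y) := by
  intro p q h
  by_contra hcon
  have h1 : finMul X Y p q = 0 := by
    by_contra h0
    exact hcon (finMul_isHom hX hY p q h0)
  have h2 : finMul Y X p q = 0 := by
    by_contra h0
    exact hcon (by rw [add_comm a b]; exact finMul_isHom hY hX p q h0)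
  exact h (by simp [homBracket, h1, h2])

theorem homBracket_symm (a b : Gr) (X Y : Matrix ℤ ℤ ℂ) :
    homBracket a b X Y = -(sgn a b • homBracket b a Y X) := by
  simp only [homBracket, sgn_comm b a]
  rcases sgn_cases a b with h | h <;> rw [h] <;> module

theorem homBracket_jacobi (a b c : Gr) {X Y Z : Matrix ℤ ℤ ℂ} (hX : X ∈ finMat)
    (hY : Y ∈ finMat) (hZ : Z ∈ finMat) :
    homBracket a (b + c) X (homBracket b c Y Z) =
      homBracket (a + b) c (homBracket a b X Y) Z +
        sgn a b • homBracket b (a + c) Y (homBracket a c X Z) := by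
  simp only [homBracket, finMul_sub hX, finMul_sub hY, finMul_sub hZ, sub_finMul hX, sub_finMul hY,
    sub_finMul hZ, finMul_smul hX, finMul_smul hY, finMul_smul hZ, smul_finMul hX, smul_finMul hY,
    smul_finMul hZ, finMul_assoc hX hY, finMul_assoc hX hZ, finMul_assoc hY hX, finMul_assoc hY hZ,
    finMul_assoc hZ hX, finMul_assoc hZ hY, sgn_add_left, sgn_add_right, sgn_comm b a]
  rcases sgn_cases a b with h1 | h1 <;> rcases sgn_cases a c with h2 | h2 <;>
    rcases sgn_cases b c with h3 | h3 <;> rw [h1, h2, h3] <;> module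

theorem finMul_entry {a b : Gr} {X Y : Matrix ℤ ℤ ℂ} (hX : EntryCond X) (hY : EntryCond Y)
    (hXa : IsHom a X) (hYb : IsHom b Y) (p q : ℤ) :
    finMul X Y p q = (lam p q * (sg p * sg q) * sgn a b) * finMul Y X (sw q) (sw p) := by
  simp only [finMul]
  rw [← finsum_comp_equiv swEquiv (f := fun r => Y (sw q) r * X r (sw p)), ← smul_eq_mul, smul_finsum]
  refine finsum_congr fun r => ?_
  change X p r * Y r q = _ * (Y (sw q) (sw r) * X (sw r) (sw p))
  rw [hX p r, hY r q]
  by_cases h1 : X (sw r) (sw p) = 0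
  · simp [h1]
  by_cases h2 : Y (sw q) (sw r) = 0
  · simp [h2]
  have e1 := hXa _ _ h1
  have e2 := hYb _ _ h2
  rw [posDeg_sw] at e1 e2
  have e3 := lam_mul p q r
  rw [e1, e2] at e3
  have e4 := sg_mul_self r
  linear_combination (sg p * sg r * sg r * sg q * X (sw r) (sw p) * Y (sw q) (sw r)) * e3 +
    (sgn a b * lam p q * sg p * sg q * X (sw r) (sw p) * Y (sw q) (sw r)) * e4

theorem homBracket_entry {a b : Gr} {X Y : Matrix ℤ ℤ ℂ} (hX : EntryCond X) (hY : EntryCond Y)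
    (hXa : IsHom a X) (hYb : IsHom b Y) : EntryCond (homBracket a b X Y) := by
  intro p q
  simp only [homBracket, Matrix.sub_apply, Matrix.smul_apply, smul_eq_mul]
  rw [finMul_entry hX hY hXa hYb p q, finMul_entry hY hX hYb hXa p q, sgn_comm b a]
  linear_combination (-(lam p q * (sg p * sg q)) * finMul X Y (sw q) (sw p)) * sgn_mul_self a b

theorem EntryCond.comp {Y : Matrix ℤ ℤ ℂ} (hY : EntryCond Y) (a : Gr) :
    EntryCond (comp a Y) := by
  intro p q
  simp only [Parastatistics.comp, posDeg_sw]
  split_ifs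
  · exact hY p q
  · simp

/-! #### The graded Lie superalgebra -/

/-- The vector space underlying `pso(∞|∞)`. -/
def psoSpace : Submodule ℂ (Matrix ℤ ℤ ℂ) where
  carrier := {Y | IsPso Y}
  zero_mem' := EntryCond.isPso (fun p q => by simp) finMat.zero_mem
  add_mem' := fun {X Y} hX hY => EntryCond.isPso
    (fun p q => by
      rw [Matrix.add_apply, Matrix.add_apply, IsPso.entryCond hX p q, IsPso.entryCond hY p q]
      ring)
    (finMat.add_mem hX.finite hY.finite)
  smul_mem' := fun t X hX => EntryCond.isPso
    (fun p q => by
      rw [Matrix.smul_apply, Matrix.smul_apply, IsPso.entryCond hX p q, smul_eq_mul, smul_eq_mul]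
      ring)
    (finMat.smul_mem t hX.finite)

theorem psoSpace_finMat (Y : psoSpace) : (Y : Matrix ℤ ℤ ℂ) ∈ finMat := Y.2.finite

theorem comp_mem_psoSpace (a : Gr) {Y : Matrix ℤ ℤ ℂ} (hY : Y ∈ psoSpace) :
    comp a Y ∈ psoSpace :=
  EntryCond.isPso ((IsPso.entryCond hY).comp a) (comp_mem a hY.finite)

theorem matBracket_mem {X Y : Matrix ℤ ℤ ℂ} (hX : X ∈ psoSpace) (hY : Y ∈ psoSpace) :
    matBracket X Y ∈ psoSpace := by
  rw [matBracket_eq]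
  refine sum_mem fun a _ => sum_mem fun b _ => ?_
  exact EntryCond.isPso
    (homBracket_entry ((IsPso.entryCond hX).comp a) ((IsPso.entryCond hY).comp b)
      (comp_isHom a X) (comp_isHom b Y))
    (homBracket_mem a b (comp_mem a hX.finite) (comp_mem b hY.finite))

/-- The `ℤ₂ × ℤ₂`-graded Lie superalgebra `pso(∞|∞)`. -/
instance instPso : GradedLieSuperalgebra psoSpace where
  grade a :=
    { carrier := {Y | ∀ p q, (Y : Matrix ℤ ℤ ℂ) p q ≠ 0 → posDeg p q = a}
      zero_mem' := fun p q h => absurd rfl h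
      add_mem' := fun {X Y} hX hY p q h => by
        by_cases h1 : (X : Matrix ℤ ℤ ℂ) p q = 0
        · refine hY p q fun h2 => h ?_
          rw [Submodule.coe_add, Matrix.add_apply, h1, h2, add_zero]
        · exact hX p q h1
      smul_mem' := fun t X hX p q h => hX p q fun h1 => h (by
        rw [Submodule.coe_smul, Matrix.smul_apply, h1, smul_zero]) }
  isInternal := by
    refine isInternal_of_proj _ (fun a =>
      { toFun := fun Y => ⟨comp a Y, comp_mem_psoSpace a Y.2⟩
        map_add' := fun X Y => Subtype.ext (comp_add a X Y)
        map_smul' := fun t X => Subtype.ext (comp_smul a t X) }) ?_ ?_ ?_ ?_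
    · intro a x
      exact comp_isHom a x
    · intro a x hx
      refine Subtype.ext ?_
      change comp a (x : Matrix ℤ ℤ ℂ) = x
      rw [comp_of_isHom (b := a) hx, if_pos rfl]
    · intro a b x hab hx
      refine Subtype.ext ?_
      change comp a (x : Matrix ℤ ℤ ℂ) = 0
      rw [comp_of_isHom (b := b) hx, if_neg hab]
    · intro x
      refine Subtype.ext ?_
      rw [Submodule.coe_sum]
      exact sum_comp x
  bracket := LinearMap.mk₂ ℂ (fun X Y => ⟨matBracket X Y, matBracket_mem X.2 Y.2⟩)
    (fun X X' Y => Subtype.ext (by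
      have h := fun b => comp_mem b (psoSpace_finMat Y)
      simp only [matBracket_eq, Submodule.coe_add, comp_add, add_homBracket (h _),
        Finset.sum_add_distrib]))
    (fun t X Y => Subtype.ext (by
      have h := fun b => comp_mem b (psoSpace_finMat Y)
      simp only [matBracket_eq, Submodule.coe_smul, comp_smul, smul_homBracket (h _),
        Finset.smul_sum]))
    (fun X Y Y' => Subtype.ext (by
      have h := fun b => comp_mem b (psoSpace_finMat X)
      simp only [matBracket_eq, Submodule.coe_add, comp_add, homBracket_add (h _),
        Finset.sum_add_distrib]))
    (fun t X Y => Subtype.ext (by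
      have h := fun b => comp_mem b (psoSpace_finMat X)
      simp only [matBracket_eq, Submodule.coe_smul, comp_smul, homBracket_smul (h _),
        Finset.smul_sum]))
  bracket_mem := fun a b x y hx hy => by
    change IsHom (a + b) (matBracket x y)
    rw [matBracket_of_isHom (a := a) (b := b) hx hy]
    exact homBracket_isHom hx hy
  bracket_symm := fun a b x y hx hy => Subtype.ext (by
    change matBracket x y = -(sgn a b • matBracket y x)
    rw [matBracket_of_isHom (a := a) (b := b) hx hy, matBracket_of_isHom (a := b) (b := a) hy hx]
    exact homBracket_symm a b x y)
  jacobi := fun a b c x y z hx hy hz => Subtype.ext (by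
    change matBracket x (matBracket y z) =
      matBracket (matBracket x y) z + sgn a b • matBracket y (matBracket x z)
    have hxy := homBracket_isHom (a := a) (b := b) hx hy
    have hxz := homBracket_isHom (a := a) (b := c) hx hz
    have hyz := homBracket_isHom (a := b) (b := c) hy hz
    rw [matBracket_of_isHom (a := b) (b := c) hy hz, matBracket_of_isHom (a := a) (b := b) hx hy,
      matBracket_of_isHom (a := a) (b := c) hx hz, matBracket_of_isHom (a := a) hx hyz,
      matBracket_of_isHom (b := c) hxy hz, matBracket_of_isHom (a := b) hy hxz]
    exact homBracket_jacobi a b c (psoSpace_finMat x) (psoSpace_finMat y) (psoSpace_finMat z))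

/-- The number `√2`. -/
def sqrtTwo : ℂ := ((Real.sqrt 2 : ℝ) : ℂ)

/-- The matrices `c_i^ξ` of parafermions (`i < 0`) and parabosons (`i > 0`), for `ξ = ±1`. -/
def cMatrix (i : ℤ) (ξ : ℤˣ) : Matrix ℤ ℤ ℂ :=
  if i < 0 then
    if ξ = 1 then sqrtTwo • (Matrix.single (2 * i) 0 1 - Matrix.single 0 (2 * i + 1) 1)
    else sqrtTwo • (Matrix.single 0 (2 * i) 1 - Matrix.single (2 * i + 1) 0 1)
  else
    if ξ = 1 then sqrtTwo • (Matrix.single 0 (2 * i) 1 + Matrix.single (2 * i - 1) 0 1)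
    else sqrtTwo • (Matrix.single 0 (2 * i - 1) 1 - Matrix.single (2 * i) 0 1)

theorem single_mem_finMat (i j : ℤ) : (Matrix.single i j 1 : Matrix ℤ ℤ ℂ) ∈ finMat := by
  refine Set.Finite.subset (Set.finite_singleton (i, j)) ?_
  rintro ⟨p, q⟩ h
  by_contra hcon
  refine h (Matrix.single_apply_of_ne _ _ _ _ _ ?_)
  rintro ⟨rfl, rfl⟩
  exact hcon rfl

theorem cMatrix_mem (i : ZStar) (ξ : ℤˣ) : cMatrix i ξ ∈ psoSpace := by
  obtain ⟨i, hi⟩ := i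
  refine EntryCond.isPso ?_ ?_
  · intro p q
    have hi' : i ≠ 0 := hi
    have k0 : ∀ p, 0 = sw p ↔ 0 = p := fun p => by rw [eq_comm, sw_zero, eq_comm]
    rcases lt_or_gt_of_ne hi' with h | h
    · have k1 : ∀ p, 2 * i = sw p ↔ 2 * i + 1 = p := fun p => by
        unfold sw; split_ifs <;> omega
      have k2 : ∀ p, 2 * i + 1 = sw p ↔ 2 * i = p := fun p => by
        unfold sw; split_ifs <;> omega
      have s1 : sg (2 * i) = 1 := if_neg (by omega)
      have s2 : sg (2 * i + 1) = 1 := if_neg (by omega)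
      have s0 : sg 0 = 1 := if_neg (by omega)
      have l1 : lam (2 * i) 0 = 1 := if_neg (by omega)
      have l2 : lam (2 * i + 1) 0 = 1 := if_neg (by omega)
      have l3 : lam 0 (2 * i) = 1 := if_neg (by omega)
      have l4 : lam 0 (2 * i + 1) = 1 := if_neg (by omega)
      simp only [cMatrix, if_pos h]
      split_ifs <;>
        simp only [Matrix.smul_apply, Matrix.sub_apply, Matrix.single_apply, k0, k1, k2,
          smul_eq_mul] <;> grind only
    · have k1 : ∀ p, 2 * i - 1 = sw p ↔ 2 * i = p := fun p => by
        unfold sw; split_ifs <;> omega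
      have k2 : ∀ p, 2 * i = sw p ↔ 2 * i - 1 = p := fun p => by
        unfold sw; split_ifs <;> omega
      have s1 : sg (2 * i) = -1 := if_pos (by omega)
      have s2 : sg (2 * i - 1) = 1 := if_neg (by omega)
      have s0 : sg 0 = 1 := if_neg (by omega)
      have l1 : lam (2 * i) 0 = -1 := if_pos (by omega)
      have l2 : lam (2 * i - 1) 0 = -1 := if_pos (by omega)
      have l3 : lam 0 (2 * i) = 1 := if_neg (by omega)
      have l4 : lam 0 (2 * i - 1) = 1 := if_neg (by omega)
      simp only [cMatrix, if_neg h.not_gt]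
      split_ifs <;>
        simp only [Matrix.smul_apply, Matrix.sub_apply, Matrix.add_apply, Matrix.single_apply, k0,
          k1, k2, smul_eq_mul] <;> grind only
  · change cMatrix i ξ ∈ finMat
    unfold cMatrix
    split_ifs <;> refine finMat.smul_mem _ ?_
    · exact sub_mem (single_mem_finMat _ _) (single_mem_finMat _ _)
    · exact sub_mem (single_mem_finMat _ _) (single_mem_finMat _ _)
    · exact add_mem (single_mem_finMat _ _) (single_mem_finMat _ _)
    · exact sub_mem (single_mem_finMat _ _) (single_mem_finMat _ _)

/-- The element `c_i^ξ` of `pso(∞|∞)`. -/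
def cPso (i : ZStar) (ξ : ℤˣ) : psoSpace := ⟨cMatrix i ξ, cMatrix_mem i ξ⟩

end Parastatistics

end

/-! Write `sw` for the involution exchanging the two indices of a block and fixing `0`. The defining
conditions say `Y p q = -kap p q * Y (sw q) (sw p)` with signs `kap`, so `pso(∞|∞)` is spanned by
the symmetrized matrix units `eMat p q`. For `p ≠ 0` the matrix `eMat p 0` is, up to a factor `±√2`,
one of the generators, and every nonzero row index arises exactly once. The bracket of `eMat p 0`
and `eMat q 0` is a sign times `eMat p (sw q)`, and bracketing this again with `eMat r 0` returns a
combination of `eMat p 0` and `eMat q 0` (`homBracket_eMat_zero`, `homBracket_eMat`). Inserting the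
scalars gives a single formula for all triple brackets (`bracket_bracket_cPso`), of which the six
families of relations are special cases. The universal property of the presentation then yields the
homomorphism `toPso`.

To see that it is bijective, let `V` be the span of the abstract generators. The relations put
`[[V,V],V]` inside `V`, so by the Jacobi identity `V + [V,V]` is closed under the bracket and is the
whole algebra (`genSpan_sup_genSpanTwo`). No linear relation can be lost under `toPso`: the
identities between `eMat p q` and its mirror image `eMat (sw q) (sw p)` are precisely the graded
symmetry of the bracket of two generators.

This is made explicit by an inverse `ofPso`, defined linearly on matrix entries: an entry in column
`0` goes to the matching generator, an entry in row `0` contributes nothing because it repeats its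
mirror image, and any other entry goes to half of a signed bracket of two generators, its mirror
image supplying the other half. One composite is the identity because it is so on `V` and on
brackets of two generators; the other is checked entry by entry. Both maps preserve degrees. -/

noncomputable section

namespace Parastatistics

open GradedLieSuperalgebra

/-! ### Evaluating the free non-associative algebra in a graded Lie superalgebra -/

section Evaluation

variable {X L : Type*} [AddCommGroup L] [Module ℂ L] [GradedLieSuperalgebra L]

/-- The value in `L` of a non-associative word, for given values of the generators. -/
def evalWord (f : X → L) : FreeMagma X → L
  | .of x => f x
  | .mul u v => bracket (evalWord f u) (evalWord f v)

/-- The linear map from the free non-associative algebra to `L` that extends a map on the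
generators and sends products to brackets. -/
def freeEval (f : X → L) : FreeNonUnitalNonAssocAlgebra ℂ X →ₗ[ℂ] L :=
  (Finsupp.linearCombination ℂ (evalWord f)) ∘ₗ (MonoidAlgebra.coeffLinearEquiv ℂ).toLinearMap

theorem freeEval_single (f : X → L) (u : FreeMagma X) (t : ℂ) :
    freeEval f (MonoidAlgebra.single u t) = t • evalWord f u := by
  simp only [freeEval, LinearMap.comp_apply]
  have : (MonoidAlgebra.coeffLinearEquiv (S := ℂ) (M := FreeMagma X) ℂ).toLinearMap
      (MonoidAlgebra.single u t) = Finsupp.single u t := rfl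
  rw [this, Finsupp.linearCombination_single]

theorem freeEval_of (f : X → L) (x : X) :
    freeEval f (FreeNonUnitalNonAssocAlgebra.of ℂ x) = f x :=
  (freeEval_single f (FreeMagma.of x) 1).trans (one_smul _ _)

theorem freeEval_mul (f : X → L) (x y : FreeNonUnitalNonAssocAlgebra ℂ X) :
    freeEval f (x * y) = bracket (freeEval f x) (freeEval f y) := by
  induction x using MonoidAlgebra.induction_linear with
  | zero => simp
  | add x x' hx hx' => simp only [add_mul, map_add, hx, hx', LinearMap.add_apply]
  | single u s =>
    induction y using MonoidAlgebra.induction_linear with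
    | zero => simp
    | add y y' hy hy' => simp only [mul_add, map_add, hy, hy']
    | single v t =>
      rw [MonoidAlgebra.single_mul_single, freeEval_single, freeEval_single, freeEval_single,
        map_smul, map_smul, LinearMap.smul_apply, smul_smul, mul_comm t s]
      rfl

/-- Graded symmetry and the Jacobi identity hold in `L` only for homogeneous elements; this makes
them available for the values of the homogeneous elements appearing in `InIdeal`. -/
theorem freeEval_mem_grade (deg : X → Gr) (f : X → L) (hf : ∀ x, f x ∈ grade (deg x)) (a : Gr)
    (x : FreeNonUnitalNonAssocAlgebra ℂ X) (hx : x ∈ freeGrade deg a) :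
    freeEval f x ∈ grade (L := L) a := by
  have word : ∀ u, evalWord f u ∈ grade (L := L) (wordDeg deg u) := by
    intro u
    induction u with
    | ih1 x => exact hf x
    | ih2 u v hu hv => exact bracket_mem _ _ _ _ hu hv
  induction hx using Submodule.span_induction with
  | mem x h =>
    obtain ⟨u, rfl, rfl⟩ := h
    rw [freeEval_single, one_smul]
    exact word u
  | zero => simp
  | add x y _ _ hx hy => rw [map_add]; exact add_mem hx hy
  | smul t x _ hx => rw [map_smul]; exact Submodule.smul_mem _ _ hx

theorem freeEval_eq_zero (deg : X → Gr) (f : X → L) (hf : ∀ x, f x ∈ grade (deg x))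
    (R : Set (FreeNonUnitalNonAssocAlgebra ℂ X)) (hR : ∀ r ∈ R, freeEval f r = 0)
    (x : FreeNonUnitalNonAssocAlgebra ℂ X) (hx : x ∈ ideal deg R) : freeEval f x = 0 := by
  change InIdeal deg R x at hx
  induction hx with
  | rel r hr => exact hR r hr
  | symm a b x y hx hy =>
    rw [map_add, map_smul, freeEval_mul, freeEval_mul,
      bracket_symm a b _ _ (freeEval_mem_grade deg f hf a x hx)
        (freeEval_mem_grade deg f hf b y hy), neg_add_cancel]
  | jacobi a b c x y z hx hy hz =>
    simp only [map_sub, map_add, map_smul, freeEval_mul]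
    rw [GradedLieSuperalgebra.jacobi a b c _ _ _ (freeEval_mem_grade deg f hf a x hx)
      (freeEval_mem_grade deg f hf b y hy) (freeEval_mem_grade deg f hf c z hz), sub_self]
  | zero => exact map_zero _
  | add x y _ _ hx hy => rw [map_add, hx, hy, add_zero]
  | smul t x _ hx => rw [map_smul, hx, smul_zero]
  | mul_left y x _ hx => rw [freeEval_mul, hx, map_zero]
  | mul_right x y _ hx => rw [freeEval_mul, hx, map_zero, LinearMap.zero_apply]

end Evaluation

/-! ### Generation and the universal property of a presented algebra -/

namespace GradedPresentation

variable (P : GradedPresentation)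

theorem gen_mem_grade (x : P.Gen) : P.gen x ∈ grade (L := P.Algebra) (P.deg x) :=
  Submodule.mem_map_of_mem (of_mem_freeGrade P.deg x)

/-- A subspace that contains the generators and is closed under the bracket is everything. -/
theorem eq_top_of_bracket_mem (S : Submodule ℂ P.Algebra) (hgen : ∀ x, P.gen x ∈ S)
    (hS : ∀ x ∈ S, ∀ y ∈ S, GradedLieSuperalgebra.bracket x y ∈ S) : S = ⊤ := by
  have word : ∀ u : FreeMagma P.Gen,
      (Submodule.Quotient.mk (MonoidAlgebra.single u 1 : FreeNonUnitalNonAssocAlgebra ℂ P.Gen) :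
        P.Algebra) ∈ S := by
    intro u
    induction u with
    | ih1 x => exact hgen x
    | ih2 u v hu hv =>
      have h := hS _ hu _ hv
      change P.bracket _ _ ∈ S at h
      rwa [bracket_mk, MonoidAlgebra.single_mul_single, one_mul] at h
  rw [eq_top_iff]
  rintro x -
  obtain ⟨x, rfl⟩ := Submodule.mkQ_surjective _ x
  induction x using MonoidAlgebra.induction_linear with
  | zero => simp
  | add x y hx hy => rw [map_add]; exact add_mem hx hy
  | single u t =>
    have : (MonoidAlgebra.single u t : FreeNonUnitalNonAssocAlgebra ℂ P.Gen) =
        t • MonoidAlgebra.single u 1 := by simp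
    rw [this, map_smul]
    exact Submodule.smul_mem _ _ (word u)

section Lift

variable {L : Type*} [AddCommGroup L] [Module ℂ L] [GradedLieSuperalgebra L] (f : P.Gen → L)
  (hf : ∀ x, f x ∈ grade (P.deg x)) (hR : ∀ r ∈ P.rels, freeEval f r = 0)

/-- The map from the presented algebra determined by homogeneous elements that satisfy the
relations. -/
def lift : P.Algebra →ₗ[ℂ] L :=
  (ideal P.deg P.rels).liftQ (freeEval f) fun x hx => freeEval_eq_zero P.deg f hf P.rels hR x hx

theorem lift_gen (x : P.Gen) : P.lift f hf hR (P.gen x) = f x :=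
  freeEval_of f x

theorem lift_bracket (x y : P.Algebra) :
    P.lift f hf hR (GradedLieSuperalgebra.bracket x y) =
      GradedLieSuperalgebra.bracket (P.lift f hf hR x) (P.lift f hf hR y) := by
  obtain ⟨x, rfl⟩ := Submodule.mkQ_surjective _ x
  obtain ⟨y, rfl⟩ := Submodule.mkQ_surjective _ y
  exact freeEval_mul f x y

theorem lift_mem_grade (a : Gr) (x : P.Algebra) (hx : x ∈ grade (L := P.Algebra) a) :
    P.lift f hf hR x ∈ grade (L := L) a := by
  obtain ⟨x, hx, rfl⟩ := hx
  exact freeEval_mem_grade P.deg f hf a x hx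

end Lift

end GradedPresentation

/-! ### The presented algebra is spanned by generators and brackets of two generators -/

/-- The span of the generators of the parastatistics algebra. -/
def genSpan : Submodule ℂ parastatistics.Algebra :=
  Submodule.span ℂ (Set.range parastatistics.gen)

/-- The span of the brackets of two generators of the parastatistics algebra. -/
def genSpanTwo : Submodule ℂ parastatistics.Algebra :=
  Submodule.map₂ bracket genSpan genSpan

theorem gen_mem_genSpan (x : ZStar × ℤˣ) : parastatistics.gen x ∈ genSpan :=
  Submodule.subset_span ⟨x, rfl⟩

theorem genSpanTwo_eq : genSpanTwo = Submodule.span ℂ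
    (Set.range fun x : (ZStar × ℤˣ) × (ZStar × ℤˣ) =>
      bracket (parastatistics.gen x.1) (parastatistics.gen x.2)) := by
  rw [genSpanTwo, genSpan, Submodule.map₂_span_span, Set.image2_range]
  rfl

theorem mk_eq_of_tripleRelator {r s : FreeNonUnitalNonAssocAlgebra ℂ (ZStar × ℤˣ)}
    (h : TripleRelator (r - s)) :
    (Submodule.Quotient.mk r : parastatistics.Algebra) = Submodule.Quotient.mk s :=
  (Submodule.Quotient.eq _).2 (InIdeal.rel (deg := cDeg) (R := {r | TripleRelator r}) _ h)

/-- Each relation equates a left-nested triple bracket with a linear expression in the generators.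
The spanning argument uses the relations only through this lemma. -/
theorem bracket_gen_gen_gen_mem (x y z : ZStar × ℤˣ) :
    bracket (bracket (parastatistics.gen x) (parastatistics.gen y)) (parastatistics.gen z) ∈
      genSpan := by
  have free : ∀ (i : ZStar) (ξ : ℤˣ), (Submodule.Quotient.mk (cFree i ξ) :
      parastatistics.Algebra) ∈ genSpan := fun i ξ => gen_mem_genSpan (i, ξ)
  have key : ∀ (r s : FreeNonUnitalNonAssocAlgebra ℂ (ZStar × ℤˣ)), TripleRelator (r - s) →
      (Submodule.Quotient.mk s : parastatistics.Algebra) ∈ genSpan →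
      (Submodule.Quotient.mk r : parastatistics.Algebra) ∈ genSpan := fun r s h hs => by
    rwa [mk_eq_of_tripleRelator h]
  have zero : ∀ r : FreeNonUnitalNonAssocAlgebra ℂ (ZStar × ℤˣ), TripleRelator r →
      (Submodule.Quotient.mk r : parastatistics.Algebra) ∈ genSpan := fun r h =>
    key r 0 (by rwa [sub_zero]) (zero_mem _)
  have fb : ∀ x y z : ZStar × ℤˣ, (x.1 : ℤ) < 0 → 0 < (y.1 : ℤ) →
      bracket (bracket (parastatistics.gen x) (parastatistics.gen y)) (parastatistics.gen z) ∈
        genSpan := by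
    rintro ⟨i, ξ⟩ ⟨j, η⟩ ⟨k, ε⟩ hi hj
    rcases lt_or_gt_of_ne k.2 with hk | hk
    · exact key _ _ (.fbf i j k ξ η ε hi hj hk) (Submodule.smul_mem _ _ (free _ _))
    · exact key _ _ (.fbb i j k ξ η ε hi hj hk) (Submodule.smul_mem _ _ (free _ _))
  rcases lt_or_gt_of_ne x.1.2 with hx | hx <;> rcases lt_or_gt_of_ne y.1.2 with hy | hy
  · obtain ⟨i, ξ⟩ := x
    obtain ⟨j, η⟩ := y
    obtain ⟨k, ε⟩ := z
    rcases lt_or_gt_of_ne k.2 with hk | hk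
    · exact key _ _ (.fff i j k ξ η ε hx hy hk) (sub_mem (Submodule.smul_mem _ _ (free _ _))
        (Submodule.smul_mem _ _ (free _ _)))
    · exact zero _ (.ffb i j k ξ η ε hx hy hk)
  · exact fb x y z hx hy
  -- The mixed relations are stated only with the parafermion first; the opposite order follows by
  -- graded symmetry of the inner bracket.
  · rw [bracket_symm _ _ _ _ (parastatistics.gen_mem_grade x) (parastatistics.gen_mem_grade y),
      map_neg, map_smul]
    exact neg_mem (Submodule.smul_mem _ _ (fb y x z hy hx))
  · obtain ⟨i, ξ⟩ := x
    obtain ⟨j, η⟩ := y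
    obtain ⟨k, ε⟩ := z
    rcases lt_or_gt_of_ne k.2 with hk | hk
    · exact zero _ (.bbf i j k ξ η ε hx hy hk)
    · exact key _ _ (.bbb i j k ξ η ε hx hy hk) (add_mem (Submodule.smul_mem _ _ (free _ _))
        (Submodule.smul_mem _ _ (free _ _)))

theorem bracket_genSpanTwo_genSpan {v w : parastatistics.Algebra} (hv : v ∈ genSpanTwo)
    (hw : w ∈ genSpan) : bracket v w ∈ genSpan := by
  have h := Submodule.apply_mem_map₂ (bracket (L := parastatistics.Algebra)) hv hw
  rw [genSpanTwo_eq, genSpan, Submodule.map₂_span_span] at h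
  refine Submodule.span_le.2 ?_ h
  rintro _ ⟨_, ⟨x, rfl⟩, _, ⟨z, rfl⟩, rfl⟩
  exact bracket_gen_gen_gen_mem x.1 x.2 z

/-- Graded symmetry needs homogeneous arguments, so the two factors are exchanged on spanning
elements rather than on `v` and `w`. -/
theorem bracket_genSpan_genSpanTwo {v w : parastatistics.Algebra} (hv : v ∈ genSpan)
    (hw : w ∈ genSpanTwo) : bracket v w ∈ genSpan := by
  have h := Submodule.apply_mem_map₂ (bracket (L := parastatistics.Algebra)) hv hw
  rw [genSpanTwo_eq, genSpan, Submodule.map₂_span_span] at h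
  refine Submodule.span_le.2 ?_ h
  rintro _ ⟨_, ⟨z, rfl⟩, _, ⟨x, rfl⟩, rfl⟩
  have hx := bracket_mem _ _ _ _ (parastatistics.gen_mem_grade x.1)
    (parastatistics.gen_mem_grade x.2)
  simp only
  rw [bracket_symm _ _ _ _ (parastatistics.gen_mem_grade z) hx]
  exact neg_mem (Submodule.smul_mem _ _ (bracket_gen_gen_gen_mem x.1 x.2 z))

theorem bracket_genSpanTwo_genSpanTwo {v w : parastatistics.Algebra} (hv : v ∈ genSpanTwo)
    (hw : w ∈ genSpanTwo) : bracket v w ∈ genSpanTwo := by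
  have h' : Submodule.map₂ (bracket (L := parastatistics.Algebra)) genSpanTwo genSpanTwo ≤
      genSpanTwo := by
    conv_lhs => rw [genSpanTwo_eq, Submodule.map₂_span_span]
    refine Submodule.span_le.2 ?_
    rintro _ ⟨_, ⟨x, rfl⟩, _, ⟨y, rfl⟩, rfl⟩
    have hx := bracket_mem _ _ _ _ (parastatistics.gen_mem_grade x.1)
      (parastatistics.gen_mem_grade x.2)
    have hx' : bracket (parastatistics.gen x.1) (parastatistics.gen x.2) ∈ genSpanTwo :=
      Submodule.apply_mem_map₂ _ (gen_mem_genSpan _) (gen_mem_genSpan _)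
    simp only
    -- A bracket of two generators acts as a graded derivation that maps `genSpan` to itself, hence
    -- it also preserves the brackets of elements of `genSpan`.
    rw [GradedLieSuperalgebra.jacobi _ _ _ _ _ _ hx (parastatistics.gen_mem_grade y.1)
      (parastatistics.gen_mem_grade y.2)]
    exact add_mem
      (Submodule.apply_mem_map₂ _ (bracket_genSpanTwo_genSpan hx' (gen_mem_genSpan _))
        (gen_mem_genSpan _))
      (Submodule.smul_mem _ _ (Submodule.apply_mem_map₂ _ (gen_mem_genSpan _)
        (bracket_genSpanTwo_genSpan hx' (gen_mem_genSpan _))))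
  exact h' (Submodule.apply_mem_map₂ _ hv hw)

theorem genSpan_sup_genSpanTwo : genSpan ⊔ genSpanTwo = ⊤ := by
  refine parastatistics.eq_top_of_bracket_mem _
    (fun x => Submodule.mem_sup_left (gen_mem_genSpan x)) ?_
  intro x hx y hy
  obtain ⟨x₁, hx₁, x₂, hx₂, rfl⟩ := Submodule.mem_sup.1 hx
  obtain ⟨y₁, hy₁, y₂, hy₂, rfl⟩ := Submodule.mem_sup.1 hy
  simp only [map_add, LinearMap.add_apply]
  exact add_mem
    (add_mem (Submodule.mem_sup_right (Submodule.apply_mem_map₂ _ hx₁ hy₁))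
      (Submodule.mem_sup_left (bracket_genSpanTwo_genSpan hx₂ hy₁)))
    (add_mem (Submodule.mem_sup_left (bracket_genSpan_genSpanTwo hx₁ hy₂))
      (Submodule.mem_sup_right (bracket_genSpanTwo_genSpanTwo hx₂ hy₂)))

/-- Linear maps that agree on the generators and on their brackets are equal. -/
theorem parastatistics_hom_ext {M : Type*} [AddCommGroup M] [Module ℂ M]
    {f g : parastatistics.Algebra →ₗ[ℂ] M}
    (h₁ : ∀ x, f (parastatistics.gen x) = g (parastatistics.gen x))
    (h₂ : ∀ x y, f (bracket (parastatistics.gen x) (parastatistics.gen y)) =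
      g (bracket (parastatistics.gen x) (parastatistics.gen y))) : f = g := by
  have : (⊤ : Submodule ℂ parastatistics.Algebra) ≤ LinearMap.eqLocus f g := by
    rw [← genSpan_sup_genSpanTwo, genSpanTwo_eq]
    refine sup_le (Submodule.span_le.2 ?_) (Submodule.span_le.2 ?_)
    · rintro _ ⟨x, rfl⟩
      exact h₁ x
    · rintro _ ⟨x, rfl⟩
      exact h₂ x.1 x.2
  exact LinearMap.ext fun x => this (Submodule.mem_top (x := x))

/-! ### Spanning matrices of `pso(∞|∞)` and their brackets -/

/-- The coefficient in the entrywise conditions that define `pso(∞|∞)`. -/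
def kap (p q : ℤ) : ℂ := lam p q * (sg p * sg q)

/-- The matrix obtained by symmetrizing the matrix unit at `(p, q)`. -/
def eMat (p q : ℤ) : Matrix ℤ ℤ ℂ :=
  Matrix.single p q 1 - kap p q • Matrix.single (sw q) (sw p) 1

theorem lam_mul_self (p q : ℤ) : lam p q * lam p q = 1 := by
  unfold lam; split_ifs <;> norm_num

theorem kap_mul_self (p q : ℤ) : kap p q * kap p q = 1 := by
  unfold kap
  linear_combination (sg p * sg q) ^ 2 * lam_mul_self p q + sg q ^ 2 * sg_mul_self p +
    sg_mul_self q

theorem sw_zero' : sw 0 = 0 := (sw_zero 0).2 rfl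

theorem sg_zero : sg 0 = 1 := if_neg (by omega)

theorem sg_of_neg {p : ℤ} (hp : p < 0) : sg p = 1 := if_neg (by omega)

theorem sg_sw_of_pos {p : ℤ} (hp : 0 < p) : sg (sw p) = -sg p := by
  unfold sg sw
  split_ifs <;> first | omega | norm_num

theorem sg_sw_of_neg {p : ℤ} (hp : p < 0) : sg (sw p) = sg p := by
  rw [sg_of_neg hp, sg_of_neg ((sw_neg p).2 hp)]

theorem posDeg_sw_left (p q : ℤ) : posDeg (sw p) q = posDeg p q := by
  rw [posDeg, rowDeg_sw, posDeg]

/-- This compatibility of the commutation sign with the symmetrizing sign is what lets the two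
products in a graded bracket of `eMat p 0` and `eMat q 0` combine into one symmetrized unit. -/
theorem sgn_mul_kap (p q : ℤ) (hp : p ≠ 0) (hq : q ≠ 0) :
    sgn (posDeg p 0) (posDeg q 0) * kap p 0 = kap q 0 * kap p (sw q) := by
  have h11 : (1 + 1 : ZMod 2) = 0 := by decide
  have h := sg_mul_self q
  rcases lt_or_gt_of_ne hp with hp | hp <;> rcases lt_or_gt_of_ne hq with hq | hq <;>
    simp [kap, sg_sw_of_pos, sg_zero, lam, sw_neg, sw_pos, sw_zero, posDeg, rowDeg,
      sgn, ZMod.val_one, *, not_lt_of_gt, ne_of_gt, sg_of_neg]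
  all_goals linear_combination -(sg p) * h

/-- `I` is symmetric and `J` antisymmetric, so passing to the block partner changes the sign exactly
for `p > 0`; likewise degree `(1,1)` has self-sign `1` and degree `(1,0)` has self-sign `-1`. -/
theorem kap_sw_left (p : ℤ) (hp : p ≠ 0) :
    kap (sw p) 0 = sgn (posDeg p 0) (posDeg p 0) * kap p 0 := by
  have h11 : (1 + 1 : ZMod 2) = 0 := by decide
  rcases lt_or_gt_of_ne hp with hp | hp <;>
    simp [kap, sg_sw_of_pos, sg_sw_of_neg, sg_zero, lam, sw_neg, sw_pos, posDeg, rowDeg, sgn,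
      ZMod.val_one, *, not_lt_of_gt, ne_of_gt]

theorem finMul_single_single (i j k l : ℤ) :
    finMul (Matrix.single i j 1) (Matrix.single k l 1) =
      if j = k then Matrix.single i l 1 else 0 := by
  ext p q
  rw [finMul, finsum_eq_single _ j]
  · by_cases h : j = k <;> by_cases hp : i = p <;> by_cases hq : l = q <;>
      simp [h, hp, hq, eq_comm]
  · intro r hr
    simp [Matrix.single_apply, hr.symm]

theorem smul_single_mem_finMat (t : ℂ) (i j : ℤ) :
    t • (Matrix.single i j 1 : Matrix ℤ ℤ ℂ) ∈ finMat :=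
  finMat.smul_mem _ (single_mem_finMat i j)

theorem finMul_eMat_eMat (p q r u : ℤ) : finMul (eMat p q) (eMat r u) =
    (if q = r then Matrix.single p u 1 else 0)
    - kap r u • (if q = sw u then Matrix.single p (sw r) 1 else 0)
    - kap p q • (if sw p = r then Matrix.single (sw q) u 1 else 0)
    + (kap p q * kap r u) • (if sw p = sw u then Matrix.single (sw q) (sw r) 1 else 0) := by
  have h1 := single_mem_finMat
  have h2 := smul_single_mem_finMat
  unfold eMat
  rw [finMul_sub (sub_mem (h1 _ _) (h2 _ _ _)), sub_finMul (h1 _ _), sub_finMul (h2 _ _ _),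
    finMul_smul (h1 _ _), smul_finMul (h1 _ _), smul_finMul (h2 _ _ _), finMul_smul (h1 _ _)]
  simp only [finMul_single_single]
  module

theorem eMat_zero_isHom (p : ℤ) : IsHom (posDeg p 0) (eMat p 0) := by
  intro a b h
  by_contra hcon
  refine h ?_
  simp only [eMat, Matrix.sub_apply, Matrix.smul_apply, smul_eq_mul, Matrix.single_apply]
  rw [if_neg, if_neg]
  · simp
  · rintro ⟨rfl, rfl⟩
    exact hcon (posDeg_sw p 0)
  · rintro ⟨rfl, rfl⟩
    exact hcon rfl

/-- The bracket of two spanning matrices in the central column. -/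
theorem homBracket_eMat_zero (p q : ℤ) (hp : p ≠ 0) (hq : q ≠ 0) :
    homBracket (posDeg p 0) (posDeg q 0) (eMat p 0) (eMat q 0) = -kap q 0 • eMat p (sw q) := by
  have hp' : sw p ≠ 0 := fun h => hp ((sw_zero p).1 h)
  have hq' : sw q ≠ 0 := fun h => hq ((sw_zero q).1 h)
  have e1 := sgn_mul_kap p q hp hq
  rw [homBracket, finMul_eMat_eMat, finMul_eMat_eMat, sw_zero', if_neg hp.symm, if_neg hq.symm,
    if_pos rfl, if_pos rfl, if_neg hp', if_neg hq', eMat, sw_sw]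
  -- Only for `sw p = q` do the products reach the central position `(0, 0)`; there the two
  -- contributions cancel by `kap_sw_left`.
  by_cases h : sw p = q
  · subst h
    have e2 := kap_sw_left p hp
    have e3 := sgn_mul_self (posDeg p 0) (posDeg p 0)
    simp only [posDeg_sw_left, sw_sw] at e1 e2 ⊢
    rw [e2] at e1 ⊢
    match_scalars
    · ring
    · linear_combination kap p 0 * e3
    · linear_combination e1
  · rw [if_neg h, if_neg (fun h' => h (by rw [← h', sw_sw]))]
    match_scalars
    · ring
    · linear_combination e1

/-- The bracket of a spanning matrix with one in the central column. -/
theorem homBracket_eMat (p q r : ℤ) (hp : p ≠ 0) (hq : q ≠ 0) :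
    homBracket (posDeg p 0 + posDeg q 0) (posDeg r 0) (eMat p (sw q)) (eMat r 0) =
      (if sw q = r then eMat p 0 else 0)
      - kap p (sw q) • (if sw p = r then eMat q 0 else 0) := by
  have hp' : sw p ≠ 0 := fun h => hp ((sw_zero p).1 h)
  have hq' : sw q ≠ 0 := fun h => hq ((sw_zero q).1 h)
  have c1 : sw r = p ↔ sw p = r := ⟨fun h => by rw [← h, sw_sw], fun h => by rw [← h, sw_sw]⟩
  have c2 : sw r = q ↔ sw q = r := ⟨fun h => by rw [← h, sw_sw], fun h => by rw [← h, sw_sw]⟩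
  rw [homBracket, finMul_eMat_eMat, finMul_eMat_eMat, sw_zero', if_neg hp.symm, if_neg hp',
    if_neg hq']
  simp only [sw_sw, c1, c2, hq.symm, if_false, eMat, sw_zero']
  have e1 := sgn_mul_kap p q hp hq
  have e3 := sgn_mul_self (posDeg p 0) (posDeg p 0)
  have e4 := sgn_mul_self (posDeg q 0) (posDeg q 0)
  have e5 := sgn_mul_self (posDeg p 0) (posDeg q 0)
  -- The entries in column `0` agree on both sides as they stand. `f1` and `f2` match the entries in
  -- row `0`, which come from the product in the opposite order.
  have f1 : sw q = r → sgn (posDeg p 0 + posDeg q 0) (posDeg r 0) * kap r 0 * kap p (sw q) =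
      kap p 0 := by
    rintro rfl
    rw [kap_sw_left q hq, posDeg_sw_left, sgn_add_left]
    linear_combination (sgn (posDeg p 0) (posDeg q 0) * kap q 0 * kap p (sw q)) * e4 -
      sgn (posDeg p 0) (posDeg q 0) * e1 + kap p 0 * e5
  have f2 : sw p = r → sgn (posDeg p 0 + posDeg q 0) (posDeg r 0) * kap r 0 =
      kap q 0 * kap p (sw q) := by
    rintro rfl
    rw [kap_sw_left p hp, posDeg_sw_left, sgn_add_left, sgn_comm (posDeg q 0)]
    linear_combination (sgn (posDeg p 0) (posDeg q 0) * kap p 0) * e3 + e1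
  by_cases h1 : sw q = r <;> by_cases h2 : sw p = r <;>
    simp only [h1, h2, if_true, if_false, forall_const, false_implies] at f1 f2 ⊢
  · linear_combination (norm := module) f2 • Matrix.single 0 r (1 : ℂ) -
      f1 • Matrix.single 0 r (1 : ℂ)
  · linear_combination (norm := module) -f1 • Matrix.single 0 (sw p) (1 : ℂ)
  · linear_combination (norm := module) f2 • Matrix.single 0 (sw q) (1 : ℂ)
  · module

/-! ### The triple relations in `pso(∞|∞)` -/

/-- The row of the matrix `c_i^ξ` that has its nonzero entry in the central column. -/
def idx (x : ZStar × ℤˣ) : ℤ :=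
  if (x.1 : ℤ) < 0 then if x.2 = 1 then 2 * x.1 else 2 * x.1 + 1
  else if x.2 = 1 then 2 * x.1 - 1 else 2 * x.1

theorem neg_one_ne_one_units : (-1 : ℤˣ) ≠ 1 := by decide

theorem idx_ne_zero (x : ZStar × ℤˣ) : idx x ≠ 0 := by
  have h := x.1.2
  unfold idx
  split_ifs <;> omega

theorem idx_injective : Function.Injective idx := by
  rintro ⟨⟨i, hi⟩, ξ⟩ ⟨⟨j, hj⟩, η⟩ h
  rcases Int.units_eq_one_or ξ with rfl | rfl <;> rcases Int.units_eq_one_or η with rfl | rfl <;>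
    simp only [idx, neg_one_ne_one_units, if_true, if_false] at h <;> split_ifs at h <;>
    first
    | omega
    | (obtain rfl : i = j := by omega
       rfl)

/-- With `idx_injective`, this identifies the generators with the nonzero indices. Integer division
rounds down, so negative blocks `2i, 2i + 1` need `p / 2`, and positive blocks `2i - 1, 2i` need `(p
+ 1) / 2`, which equals `p / 2` for even `p`. -/
theorem exists_idx_eq {p : ℤ} (hp : p ≠ 0) : ∃ x, idx x = p := by
  rcases lt_or_gt_of_ne hp with h | h <;> rcases Int.emod_two_eq_zero_or_one p with h2 | h2
  · exact ⟨(⟨p / 2, by omega⟩, 1), by simp only [idx, if_true]; rw [if_pos (by omega)]; omega⟩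
  · exact ⟨(⟨p / 2, by omega⟩, -1), by
      simp only [idx, neg_one_ne_one_units, if_false]; rw [if_pos (by omega)]; omega⟩
  · exact ⟨(⟨p / 2, by omega⟩, -1), by
      simp only [idx, neg_one_ne_one_units, if_false]; rw [if_neg (by omega)]; omega⟩
  · exact ⟨(⟨(p + 1) / 2, by omega⟩, 1), by
      simp only [idx, if_true]; rw [if_neg (by omega)]; omega⟩

/-- Block partners are the creation and annihilation operators of the same index; this is the source
of the Kronecker deltas and sign differences in the relations. -/
theorem sw_idx (i : ZStar) (ξ : ℤˣ) : sw (idx (i, ξ)) = idx (i, -ξ) := by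
  have h := i.2
  rcases Int.units_eq_one_or ξ with rfl | rfl <;>
    simp only [idx, neg_neg, neg_one_ne_one_units, if_true, if_false] <;> split_ifs <;>
    unfold sw <;> split_ifs <;> omega

theorem posDeg_idx (x : ZStar × ℤˣ) : posDeg (idx x) 0 = cDeg x := by
  have h := x.1.2
  have h11 : ((0, 1) : Gr) + (1, 1) = (1, 0) := by decide
  by_cases hx : (x.1 : ℤ) < 0
  · have : idx x < 0 := by unfold idx; split_ifs; all_goals omega
    simp [posDeg, rowDeg, cDeg, hx, this]
  · have : 0 < idx x := by unfold idx; split_ifs; all_goals omega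
    simp [posDeg, rowDeg, cDeg, hx, this.not_gt, this.ne', h11]

theorem kap_idx_of_neg {i : ZStar} (hi : (i : ℤ) < 0) (ξ : ℤˣ) : kap (idx (i, ξ)) 0 = 1 := by
  have : idx (i, ξ) < 0 := by simp only [idx, hi, if_true]; split_ifs <;> omega
  simp [kap, lam, sg_of_neg this, sg_zero, this.not_gt]

theorem kap_idx_of_pos {i : ZStar} (hi : 0 < (i : ℤ)) (ξ : ℤˣ) :
    kap (idx (i, ξ)) 0 = -((ξ : ℤ) : ℂ) := by
  have : 0 < idx (i, ξ) := by simp only [idx, hi.not_gt, if_false]; split_ifs <;> omega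
  rcases Int.units_eq_one_or ξ with rfl | rfl <;>
    simp [kap, lam, sg, this] <;> simp [idx, hi.not_gt]

/-- The scalar that relates `c_i^ξ` to a spanning matrix. -/
def cCoeff (x : ZStar × ℤˣ) : ℂ := sqrtTwo * ((x.2 : ℤ) : ℂ)

theorem sqrtTwo_mul_self : sqrtTwo * sqrtTwo = 2 := by
  rw [sqrtTwo, ← Complex.ofReal_mul, Real.mul_self_sqrt (by norm_num)]
  norm_num

theorem units_mul_self (ξ : ℤˣ) : ((ξ : ℤ) : ℂ) * ((ξ : ℤ) : ℂ) = 1 := by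
  rcases Int.units_eq_one_or ξ with rfl | rfl <;> simp

theorem cCoeff_mul_self (x : ZStar × ℤˣ) : cCoeff x * cCoeff x = 2 := by
  unfold cCoeff
  linear_combination sqrtTwo_mul_self + sqrtTwo * sqrtTwo * units_mul_self x.2

theorem cCoeff_ne_zero (x : ZStar × ℤˣ) : cCoeff x ≠ 0 := fun h => by
  have := cCoeff_mul_self x
  simp [h] at this

theorem coe_cPso (x : ZStar × ℤˣ) :
    (cPso x.1 x.2 : Matrix ℤ ℤ ℂ) = cCoeff x • eMat (idx x) 0 := by
  obtain ⟨⟨i, hi⟩, ξ⟩ := x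
  change cMatrix i ξ = _
  have hk : (i < 0 → kap (idx (⟨i, hi⟩, ξ)) 0 = 1) ∧
      (¬ i < 0 → kap (idx (⟨i, hi⟩, ξ)) 0 = -((ξ : ℤ) : ℂ)) :=
    ⟨fun h => kap_idx_of_neg h ξ, fun h => kap_idx_of_pos (by change 0 < i; omega) ξ⟩
  rw [eMat, sw_idx, sw_zero']
  by_cases h : i < 0
  · rw [hk.1 h]
    rcases Int.units_eq_one_or ξ with rfl | rfl <;>
      simp [cMatrix, h, idx, cCoeff]
    all_goals module
  · rw [hk.2 h]
    rcases Int.units_eq_one_or ξ with rfl | rfl <;>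
      simp [cMatrix, h, idx, cCoeff]
    all_goals module

theorem cPso_mem_grade (x : ZStar × ℤˣ) : cPso x.1 x.2 ∈ grade (L := psoSpace) (cDeg x) := by
  change IsHom (cDeg x) (cPso x.1 x.2 : Matrix ℤ ℤ ℂ)
  rw [coe_cPso, ← posDeg_idx]
  intro p q h
  exact eMat_zero_isHom _ p q fun h0 => h (by rw [Matrix.smul_apply, h0, smul_zero])

theorem eMat_mem_finMat (p q : ℤ) : eMat p q ∈ finMat :=
  sub_mem (single_mem_finMat _ _) (smul_single_mem_finMat _ _ _)

theorem coe_bracket_of_mem_grade {a b : Gr} {X Y : psoSpace} (hX : X ∈ grade (L := psoSpace) a)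
    (hY : Y ∈ grade (L := psoSpace) b) :
    ((bracket X Y : psoSpace) : Matrix ℤ ℤ ℂ) = homBracket a b X Y :=
  matBracket_of_isHom (a := a) (b := b) hX hY

theorem coe_bracket_cPso (x y : ZStar × ℤˣ) :
    ((bracket (cPso x.1 x.2) (cPso y.1 y.2) : psoSpace) : Matrix ℤ ℤ ℂ) =
      (cCoeff x * cCoeff y * -kap (idx y) 0) • eMat (idx x) (sw (idx y)) := by
  rw [coe_bracket_of_mem_grade (cPso_mem_grade x) (cPso_mem_grade y), coe_cPso, coe_cPso,
    smul_homBracket (finMat.smul_mem _ (eMat_mem_finMat _ _)), homBracket_smul (eMat_mem_finMat _ _),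
    ← posDeg_idx, ← posDeg_idx, homBracket_eMat_zero _ _ (idx_ne_zero x) (idx_ne_zero y),
    smul_smul, smul_smul, mul_assoc]

/-- The structure constant in the triple brackets of the generators. -/
def tripleCoeff (y z : ZStar × ℤˣ) : ℂ :=
  if sw (idx y) = idx z then 2 * kap (idx y) 0 else 0

theorem cCoeff_mul_of_sw {y z : ZStar × ℤˣ} (h : sw (idx y) = idx z) :
    cCoeff y * cCoeff z = -2 := by
  obtain ⟨i, ξ⟩ := y
  rw [sw_idx] at h
  rw [← idx_injective h]
  have : cCoeff (i, -ξ) = -cCoeff (i, ξ) := by simp [cCoeff]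
  rw [this]
  linear_combination -cCoeff_mul_self (i, ξ)

/-- A uniform version of the six families of relations: the types of the generators enter only
through the commutation sign and the values of `tripleCoeff`. -/
theorem bracket_bracket_cPso (x y z : ZStar × ℤˣ) :
    bracket (bracket (cPso x.1 x.2) (cPso y.1 y.2)) (cPso z.1 z.2) =
      tripleCoeff y z • cPso x.1 x.2 -
        (sgn (cDeg x) (cDeg y) * tripleCoeff x z) • cPso y.1 y.2 := by
  refine Subtype.ext ?_
  rw [coe_bracket_of_mem_grade (bracket_mem _ _ _ _ (cPso_mem_grade x) (cPso_mem_grade y))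
    (cPso_mem_grade z), coe_bracket_cPso, coe_cPso z,
    smul_homBracket (finMat.smul_mem _ (eMat_mem_finMat _ _)), homBracket_smul (eMat_mem_finMat _ _)]
  simp only [← posDeg_idx]
  rw [homBracket_eMat _ _ _ (idx_ne_zero x) (idx_ne_zero y), Submodule.coe_sub,
    Submodule.coe_smul, Submodule.coe_smul, coe_cPso, coe_cPso, tripleCoeff, tripleCoeff]
  have e1 := sgn_mul_kap _ _ (idx_ne_zero x) (idx_ne_zero y)
  have f1 : sw (idx y) = idx z → cCoeff y * cCoeff z = -2 := cCoeff_mul_of_sw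
  have f2 : sw (idx x) = idx z → cCoeff x * cCoeff z = -2 := cCoeff_mul_of_sw
  -- Of the three scalars `cCoeff`, the two belonging to block partners multiply to `-2`; the third
  -- is the normalization of the surviving generator.
  have g1 : sw (idx y) = idx z → (cCoeff x * cCoeff y * -kap (idx y) 0) * cCoeff z =
      2 * kap (idx y) 0 * cCoeff x := fun h => by
    linear_combination (-kap (idx y) 0 * cCoeff x) * f1 h
  have g2 : sw (idx x) = idx z →
      (cCoeff x * cCoeff y * -kap (idx y) 0) * cCoeff z * kap (idx x) (sw (idx y)) =
      sgn (posDeg (idx x) 0) (posDeg (idx y) 0) * (2 * kap (idx x) 0) * cCoeff y := fun h => by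
    linear_combination (-kap (idx y) 0 * kap (idx x) (sw (idx y)) * cCoeff y) * f2 h -
      (2 * cCoeff y) * e1
  by_cases h1 : sw (idx y) = idx z <;> by_cases h2 : sw (idx x) = idx z <;>
    simp only [h1, h2, if_true, if_false, forall_const, false_implies] at g1 g2 ⊢
  · linear_combination (norm := module) g1 • eMat (idx x) 0 - g2 • eMat (idx y) 0
  · linear_combination (norm := module) g1 • eMat (idx x) 0
  · linear_combination (norm := module) -g2 • eMat (idx y) 0
  · module

/-- Block partners have the same index in `ZStar`, so a parafermion and a paraboson are never
partners. -/
theorem tripleCoeff_of_not_iff {j k : ZStar} (h : ¬ ((j : ℤ) < 0 ↔ (k : ℤ) < 0)) (ξ η : ℤˣ) :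
    tripleCoeff (j, ξ) (k, η) = 0 := by
  rw [tripleCoeff, if_neg]
  rw [sw_idx]
  intro h'
  obtain rfl : j = k := congrArg Prod.fst (idx_injective h')
  exact h Iff.rfl

theorem tripleCoeff_of_neg {j k : ZStar} (hj : (j : ℤ) < 0) (ξ η : ℤˣ) :
    tripleCoeff (j, ξ) (k, η) = absDiff η ξ * delta j k := by
  rw [tripleCoeff, sw_idx, kap_idx_of_neg hj, delta]
  simp only [idx_injective.eq_iff, Prod.mk.injEq]
  by_cases h : j = k
  · rcases Int.units_eq_one_or ξ with rfl | rfl <;> rcases Int.units_eq_one_or η with rfl | rfl <;>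
      simp [h, absDiff, neg_one_ne_one_units.symm]
  · simp [h]

theorem tripleCoeff_of_pos {j k : ZStar} (hj : 0 < (j : ℤ)) (ξ η : ℤˣ) :
    tripleCoeff (j, ξ) (k, η) = diff η ξ * delta j k := by
  rw [tripleCoeff, sw_idx, kap_idx_of_pos hj, delta]
  simp only [idx_injective.eq_iff, Prod.mk.injEq]
  by_cases h : j = k
  · rcases Int.units_eq_one_or ξ with rfl | rfl <;> rcases Int.units_eq_one_or η with rfl | rfl <;>
      simp [h, diff, neg_one_ne_one_units.symm]
  · simp [h]

theorem freeEval_tripleRelator (r : FreeNonUnitalNonAssocAlgebra ℂ (ZStar × ℤˣ))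
    (hr : TripleRelator r) :
    freeEval (L := psoSpace) (fun x : ZStar × ℤˣ => cPso x.1 x.2) r = 0 := by
  have cf : ∀ i ξ, freeEval (L := psoSpace) (fun x : ZStar × ℤˣ => cPso x.1 x.2) (cFree i ξ) =
      cPso i ξ := fun i ξ => freeEval_of _ (i, ξ)
  have tri := fun (i j k : ZStar) (ξ η ε : ℤˣ) => bracket_bracket_cPso (i, ξ) (j, η) (k, ε)
  have s1 : sgn (1, 1) (1, 1) = 1 := by
    simp [sgn, show (1 + 1 : ZMod 2) = 0 by decide]
  have s2 : sgn (1, 0) (1, 0) = -1 := by simp [sgn, ZMod.val_one]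
  have s3 : sgn (1, 1) (1, 0) = -1 := by simp [sgn, ZMod.val_one]
  have dn : ∀ (i : ZStar) (ξ : ℤˣ), (i : ℤ) < 0 → cDeg (i, ξ) = (1, 1) := fun i ξ h => if_pos h
  have dp : ∀ (i : ZStar) (ξ : ℤˣ), 0 < (i : ℤ) → cDeg (i, ξ) = (1, 0) :=
    fun i ξ h => if_neg h.not_gt
  cases hr with
  | fff j k l ξ η ε hj hk hl =>
    simp only [map_sub, map_smul, freeEval_mul, cf]
    rw [tri, dn _ _ hj, dn _ _ hk, s1, tripleCoeff_of_neg hj, tripleCoeff_of_neg hk]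
    module
  | bbb j k l ξ η ε hj hk hl =>
    simp only [map_sub, map_add, map_smul, freeEval_mul, cf]
    rw [tri, dp _ _ hj, dp _ _ hk, s2, tripleCoeff_of_pos hj, tripleCoeff_of_pos hk]
    module
  | ffb j k l ξ η ε hj hk hl =>
    simp only [freeEval_mul, cf]
    rw [tri, tripleCoeff_of_not_iff (by omega), tripleCoeff_of_not_iff (by omega)]
    module
  | bbf j k l ξ η ε hj hk hl =>
    simp only [freeEval_mul, cf]
    rw [tri, tripleCoeff_of_not_iff (by omega), tripleCoeff_of_not_iff (by omega)]
    module
  | fbf j k l ξ η ε hj hk hl =>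
    simp only [map_sub, map_smul, freeEval_mul, cf]
    rw [tri, dn _ _ hj, dp _ _ hk, s3, tripleCoeff_of_neg hj, tripleCoeff_of_not_iff (by omega)]
    module
  | fbb j k l ξ η ε hj hk hl =>
    simp only [map_sub, map_smul, freeEval_mul, cf]
    rw [tri, tripleCoeff_of_not_iff (j := j) (by omega), tripleCoeff_of_pos hk]
    module

/-- The homomorphism from the parastatistics algebra to `pso(∞|∞)`. -/
def toPso : parastatistics.Algebra →ₗ[ℂ] psoSpace :=
  parastatistics.lift (fun x => cPso x.1 x.2) cPso_mem_grade freeEval_tripleRelator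

theorem toPso_gen (x : ZStar × ℤˣ) : toPso (parastatistics.gen x) = cPso x.1 x.2 :=
  parastatistics.lift_gen _ _ _ x

theorem toPso_bracket (x y : parastatistics.Algebra) :
    toPso (bracket x y) = bracket (toPso x) (toPso y) :=
  parastatistics.lift_bracket _ _ _ x y

/-! ### The inverse map -/

/-- The rescaled generator of the parastatistics algebra that corresponds to the spanning matrix at
`(p, 0)`, and `0` for `p = 0`. -/
def colGen : ℤ → parastatistics.Algebra :=
  Function.extend idx (fun x => (cCoeff x)⁻¹ • parastatistics.gen x) 0

theorem gen_eq_smul_colGen (x : ZStar × ℤˣ) :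
    parastatistics.gen x = cCoeff x • colGen (idx x) := by
  rw [colGen, idx_injective.extend_apply, smul_smul, mul_inv_cancel₀ (cCoeff_ne_zero x), one_smul]

theorem colGen_zero : colGen 0 = 0 :=
  Function.extend_apply' _ _ _ fun ⟨x, hx⟩ => idx_ne_zero x hx

theorem colGen_mem_grade (p : ℤ) : colGen p ∈ grade (L := parastatistics.Algebra) (posDeg p 0) := by
  by_cases hp : p = 0
  · rw [hp, colGen_zero]
    exact zero_mem _
  · obtain ⟨x, rfl⟩ := exists_idx_eq hp
    rw [colGen, idx_injective.extend_apply, posDeg_idx]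
    exact Submodule.smul_mem _ _ (parastatistics.gen_mem_grade x)

theorem coe_toPso_colGen {p : ℤ} (hp : p ≠ 0) : (toPso (colGen p) : Matrix ℤ ℤ ℂ) = eMat p 0 := by
  obtain ⟨x, rfl⟩ := exists_idx_eq hp
  rw [colGen, idx_injective.extend_apply, map_smul, toPso_gen, Submodule.coe_smul, coe_cPso,
    smul_smul, inv_mul_cancel₀ (cCoeff_ne_zero x), one_smul]

theorem coe_toPso_bracket_colGen {p q : ℤ} (hp : p ≠ 0) (hq : q ≠ 0) :
    (toPso (bracket (colGen p) (colGen q)) : Matrix ℤ ℤ ℂ) = -kap q 0 • eMat p (sw q) := by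
  have hom : ∀ {p : ℤ}, p ≠ 0 → toPso (colGen p) ∈ grade (L := psoSpace) (posDeg p 0) :=
    fun {p} _ => parastatistics.lift_mem_grade _ _ _ _ _ (colGen_mem_grade p)
  rw [toPso_bracket, coe_bracket_of_mem_grade (hom hp) (hom hq), coe_toPso_colGen hp,
    coe_toPso_colGen hq, homBracket_eMat_zero p q hp hq]

/-- The image under the inverse map of the matrix unit at a given position. -/
def entryImage (p : ℤ × ℤ) : parastatistics.Algebra :=
  if p.2 = 0 then colGen p.1
  -- The sign cancels the one in `coe_toPso_bracket_colGen`, and the half accounts for the mirror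
  -- entry. For `p.1 = 0` the value is `0`, since `colGen 0 = 0`.
  else (2⁻¹ * -kap (sw p.2) 0) • bracket (colGen p.1) (colGen (sw p.2))

/-- The entries of a matrix of `pso(∞|∞)` as a finitely supported function. -/
def entries : psoSpace →ₗ[ℂ] (ℤ × ℤ →₀ ℂ) where
  toFun Y := Finsupp.ofSupportFinite (fun p => (Y : Matrix ℤ ℤ ℂ) p.1 p.2) (psoSpace_finMat Y)
  map_add' _ _ := Finsupp.ext fun _ => rfl
  map_smul' _ _ := Finsupp.ext fun _ => rfl

theorem entries_apply (Y : psoSpace) (p : ℤ × ℤ) : entries Y p = (Y : Matrix ℤ ℤ ℂ) p.1 p.2 :=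
  congrFun (Finsupp.ofSupportFinite_coe (hf := psoSpace_finMat Y)) p

/-- The inverse of the homomorphism to `pso(∞|∞)`. -/
def ofPso : psoSpace →ₗ[ℂ] parastatistics.Algebra :=
  Finsupp.linearCombination ℂ entryImage ∘ₗ entries

theorem entryImage_mem_grade (p : ℤ × ℤ) :
    entryImage p ∈ grade (L := parastatistics.Algebra) (posDeg p.1 p.2) := by
  obtain ⟨p, q⟩ := p
  simp only [entryImage]
  split_ifs with h
  · rw [h]
    exact colGen_mem_grade p
  · have h' := bracket_mem _ _ _ _ (colGen_mem_grade p) (colGen_mem_grade (sw q))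
    rw [posDeg_sw_left, posDeg_comm q, posDeg_add] at h'
    exact Submodule.smul_mem _ _ h'

theorem ofPso_mem_grade (a : Gr) (Y : psoSpace) (hY : Y ∈ grade (L := psoSpace) a) :
    ofPso Y ∈ grade (L := parastatistics.Algebra) a := by
  rw [ofPso, LinearMap.comp_apply, Finsupp.linearCombination_apply]
  refine Submodule.sum_mem _ fun p hp => Submodule.smul_mem _ _ ?_
  have h : (Y : Matrix ℤ ℤ ℂ) p.1 p.2 ≠ 0 := by
    rw [← entries_apply]
    exact Finsupp.mem_support_iff.1 hp
  rw [← hY p.1 p.2 h]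
  exact entryImage_mem_grade p

/-- Placing the hypothesis on the underlying matrix avoids a separate proof that `eMat p q` lies in
`psoSpace`. -/
theorem entries_of_coe_eq {Y : psoSpace} {t : ℂ} {p q : ℤ}
    (hY : (Y : Matrix ℤ ℤ ℂ) = t • eMat p q) :
    entries Y = t • (Finsupp.single (p, q) 1 - kap p q • Finsupp.single (sw q, sw p) 1) := by
  ext ⟨a, b⟩
  rw [entries_apply, hY]
  simp [eMat, Matrix.single_apply, Finsupp.single_apply]

theorem ofPso_of_coe_eq {Y : psoSpace} {t : ℂ} {p q : ℤ}
    (hY : (Y : Matrix ℤ ℤ ℂ) = t • eMat p q) :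
    ofPso Y = t • (entryImage (p, q) - kap p q • entryImage (sw q, sw p)) := by
  rw [ofPso, LinearMap.comp_apply, entries_of_coe_eq hY]
  simp [Finsupp.linearCombination_single]

theorem ofPso_comp_toPso : ofPso ∘ₗ toPso = LinearMap.id := by
  refine parastatistics_hom_ext (fun x => ?_) (fun x y => ?_)
  · rw [LinearMap.comp_apply, toPso_gen x, ofPso_of_coe_eq (coe_cPso x), LinearMap.id_apply,
      gen_eq_smul_colGen x]
    have h : sw (idx x) ≠ 0 := fun h => idx_ne_zero x ((sw_zero _).1 h)
    -- The mirror entry lies in row `0`, so its image is a bracket with `colGen 0 = 0`.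
    simp [entryImage, sw_zero', h, colGen_zero]
  · have hx := idx_ne_zero x
    have hy := idx_ne_zero y
    have hx' : sw (idx x) ≠ 0 := fun h => hx ((sw_zero _).1 h)
    have hy' : sw (idx y) ≠ 0 := fun h => hy ((sw_zero _).1 h)
    rw [gen_eq_smul_colGen x, gen_eq_smul_colGen y]
    simp only [map_smul, LinearMap.smul_apply]
    rw [LinearMap.comp_apply, LinearMap.id_apply, ofPso_of_coe_eq (coe_toPso_bracket_colGen hx hy)]
    simp only [entryImage, sw_sw, if_neg hx', if_neg hy']
    -- The mirror entry yields the bracket in reverse order; after graded symmetry, `sgn_mul_kap`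
    -- shows that each entry contributes one half of the original bracket.
    rw [bracket_symm _ _ _ _ (colGen_mem_grade (idx y)) (colGen_mem_grade (idx x)),
      sgn_comm (posDeg (idx y) 0)]
    have e1 := sgn_mul_kap _ _ hx hy
    have k1 := kap_mul_self (idx y) 0
    have k2 := kap_mul_self (idx x) (sw (idx y))
    match_scalars
    linear_combination (cCoeff x * cCoeff y) * (2⁻¹ * k1 +
      (2⁻¹ * kap (idx y) 0 * kap (idx x) (sw (idx y))) * e1 +
      (2⁻¹ * kap (idx x) (sw (idx y)) ^ 2) * k1 + 2⁻¹ * k2)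

/-- The coefficients with which the symmetrized matrix units reproduce a matrix from its
entries. -/
def weight (p : ℤ × ℤ) : ℂ := if p.2 = 0 then 1 else if p.1 = 0 then 0 else 2⁻¹

theorem coe_toPso_entryImage (p : ℤ × ℤ) :
    (toPso (entryImage p) : Matrix ℤ ℤ ℂ) = weight p • eMat p.1 p.2 := by
  obtain ⟨p, q⟩ := p
  simp only [entryImage, weight]
  split_ifs with hq hp
  · subst hq
    by_cases hp : p = 0
    · subst hp
      -- Both sides vanish: `kap 0 0 = 1`, so `eMat 0 0` is zero.
      simp [colGen_zero, eMat, sw_zero', kap, lam, sg_zero]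
    · rw [coe_toPso_colGen hp, one_smul]
  · simp [hp, colGen_zero]
  · have hq' : sw q ≠ 0 := fun h => hq ((sw_zero _).1 h)
    rw [map_smul, Submodule.coe_smul, coe_toPso_bracket_colGen hp hq', sw_sw, smul_smul]
    congr 1
    linear_combination 2⁻¹ * kap_mul_self (sw q) 0

/-- Allowing an arbitrary finitely supported `f`, not just the entries of a matrix in `psoSpace`,
makes induction on single entries possible. -/
theorem toPso_linearCombination_apply (f : ℤ × ℤ →₀ ℂ) (a b : ℤ) :
    (toPso (Finsupp.linearCombination ℂ entryImage f) : Matrix ℤ ℤ ℂ) a b =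
      weight (a, b) * f (a, b) -
        weight (sw b, sw a) * kap (sw b) (sw a) * f (sw b, sw a) := by
  induction f using Finsupp.induction_linear with
  | zero => simp
  | add f g hf hg =>
    rw [map_add, map_add, Submodule.coe_add, Matrix.add_apply, hf, hg, Finsupp.add_apply,
      Finsupp.add_apply]
    ring
  | single p t =>
    obtain ⟨p, q⟩ := p
    have c1 : sw q = a ↔ q = sw a := ⟨fun h => by rw [← h, sw_sw], fun h => by rw [h, sw_sw]⟩
    have c2 : sw p = b ↔ p = sw b := ⟨fun h => by rw [← h, sw_sw], fun h => by rw [h, sw_sw]⟩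
    rw [Finsupp.linearCombination_single, map_smul, Submodule.coe_smul, coe_toPso_entryImage]
    simp only [eMat, Matrix.smul_apply, Matrix.sub_apply, Matrix.single_apply,
      Finsupp.single_apply, Prod.mk.injEq, smul_eq_mul, c1, c2]
    simp only [and_comm (a := q = sw a)]
    have t1 : ∀ (A : Prop) [Decidable A], (if A then t else 0) = t * if A then 1 else 0 :=
      fun A _ => by split_ifs <;> simp
    have w1 : weight (p, q) * (if p = a ∧ q = b then 1 else 0) =
        weight (a, b) * (if p = a ∧ q = b then 1 else 0) := by
      split_ifs with h
      · rw [h.1, h.2]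
      · simp
    have w2 : weight (p, q) * kap p q * (if p = sw b ∧ q = sw a then 1 else 0) =
        weight (sw b, sw a) * kap (sw b) (sw a) * (if p = sw b ∧ q = sw a then 1 else 0) := by
      split_ifs with h
      · rw [h.1, h.2]
      · simp
    rw [t1, t1]
    linear_combination t * w1 - t * w2

theorem toPso_ofPso (Y : psoSpace) : toPso (ofPso Y) = Y := by
  refine Subtype.ext (Matrix.ext fun a b => ?_)
  rw [ofPso, LinearMap.comp_apply, toPso_linearCombination_apply, entries_apply, entries_apply]
  have h := IsPso.entryCond Y.2 (sw b) (sw a)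
  rw [sw_sw, sw_sw, ← kap] at h
  have k := kap_mul_self (sw b) (sw a)
  -- An entry and its mirror image have weights `1` and `0`, or `1/2` twice. The exception is the
  -- centre, where the weights add up to `2` but the entry is zero.
  have w : weight (a, b) + weight (sw b, sw a) = 1 ∨ (Y : Matrix ℤ ℤ ℂ) a b = 0 := by
    simp only [weight, sw_zero]
    by_cases ha : a = 0 <;> by_cases hb : b = 0
    · subst ha hb
      exact Or.inr Y.2.zero_zero
    · simp [ha, hb]
    · simp [ha, hb]
    · left
      simp only [ha, hb, if_false]
      norm_num
  simp only at h ⊢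
  rw [h]
  rcases w with w | w
  · linear_combination (Y : Matrix ℤ ℤ ℂ) a b * w +
      weight (sw b, sw a) * (Y : Matrix ℤ ℤ ℂ) a b * k
  · rw [w]
    ring

/-- The parastatistics algebra is isomorphic to `pso(∞|∞)`. -/
def psoEquiv : GradedLieEquiv parastatistics.Algebra psoSpace where
  toLinearEquiv := LinearEquiv.ofLinearMap toPso ofPso (LinearMap.ext toPso_ofPso) ofPso_comp_toPso
  map_bracket := toPso_bracket
  map_grade a x := by
    refine ⟨fun h => ?_, parastatistics.lift_mem_grade _ cPso_mem_grade freeEval_tripleRelator a x⟩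
    -- The degree of `x` is recovered from that of its image because the inverse also preserves
    -- degrees.
    have h' := ofPso_mem_grade a (toPso x) h
    rwa [← LinearMap.comp_apply, ofPso_comp_toPso] at h'

end Parastatistics

end

/-- `pso(∞|∞)` is, as a `ℤ₂ × ℤ₂`-graded Lie superalgebra, presented by the generators `c_i^±`
(`i ∈ ℤ*`) and the triple relations with relative paraboson relations. -/
theorem mainTheorem4 :
    ∃ e : Parastatistics.GradedLieEquiv Parastatistics.parastatistics.Algebra
        Parastatistics.psoSpace,
      ∀ (i : Parastatistics.ZStar) (ξ : ℤˣ),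
        e.toLinearEquiv (Parastatistics.parastatistics.gen (i, ξ)) = Parastatistics.cPso i ξ :=
  ⟨Parastatistics.psoEquiv, fun i ξ => Parastatistics.toPso_gen (i, ξ)⟩
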